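/- All posets are finite. An element of a poset is doubly irreducible if it has at most one lower cover and at most one upper cover; otherwise it is called reducible (in a lattice: it is the meet, or the join, of two elements different from it). The nullity of a poset is $p-q+c$, where $p,q,c$ are the numbers of edges, vertices and connected components of its cover graph. A block is a lattice whose least element $0$ is meet-reducible and whose greatest element $1$ is join-reducible. A doubly irreducible element $x$ of a poset is retractible if either there are no reducible $y,z$ with $y\prec x\prec z$, or there are such $y,z$ and $y\prec x\prec z$ is the only directed path of coverings from $y$ to $z$. The basic block associated to a poset is obtained by successively removing retractible elements that have exactly one lower and exactly one upper cover, until no such element is left, and then successively removing pendant vertices (vertices of degree one of the cover graph) until none is left. For a chain $C$ and elements $a<b$ of $C$ with $a\not\prec b$, write $]_a^b\{c\}$ for adjoining a new element $c$ that lies above exactly the elements $\le a$ and below exactly the elements $\ge b$. Let $C$ be a chain with five elements, named as indicated ($0$ and $1$ are its least and greatest elements), and define the $8$-element lattices - $B_6=C]_a^1\{c_1\}]_b^1\{c_2\}]_0^b\{c_3\}$ with $C:0\prec a\prec b\prec y\prec 1$; - $B_7=B_6^*$, the dual of $B_6$; - $B_8=C]_a^1\{c_1\}]_b^1\{c_2\}]_0^1\{c_3\}$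 with $C:0\prec a\prec b\prec y\prec 1$; - $B_9=B_8^*$; - $B_{10}=C]_a^b\{c_1\}]_0^b\{c_2\}]_0^1\{c_3\}$ with $C:0\prec a\prec x\prec b\prec 1$; - $B_{11}=B_{10}^*$; - $B_{12}=C]_a^b\{c_1\}]_a^1\{c_2\}]_0^b\{c_3\}$ with $C:0\prec a\prec x\prec b\prec 1$. For $6\le s\le 12$ let $|\mathbb{B}_s(j;4,3)|$ be the number, up to isomorphism, of blocks on $j$ elements that have exactly four reducible elements, these being pairwise comparable, have nullity three, and have $B_s$ as associated basic block. Let $P_n^2$ be the number of partitions of $n$ into exactly two positive integer parts. Proposition. For every integer $j\ge 8$ and every $s\in\{6,7,8,9,10,11,12\}$, $$|\mathbb{B}_s(j;4,3)|=\sum_{t=1}^{j-7}\ \sum_{r=1}^{j-t-6}\ \sum_{l=1}^{j-t-r-5}\ \sum_{i=1}^{j-t-r-l-4}P^{2}_{j-t-r-l-i-2}.$$ -/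

import Mathlib

/-! ### Finite posets: covers, irreducible elements, nullity -/

/-- `x` is doubly irreducible in the poset `P`: at most one lower cover and at most one
upper cover. -/
def DoublyIrr {P : Type*} [PartialOrder P] (x : P) : Prop :=
  (∀ y z : P, y ⋖ x → z ⋖ x → y = z) ∧ (∀ y z : P, x ⋖ y → x ⋖ z → y = z)

/-- Membership in `Irr*(P)`: exactly one lower cover and exactly one upper cover. -/
def IrrStar {P : Type*} [PartialOrder P] (x : P) : Prop :=
  (∃! y : P, y ⋖ x) ∧ (∃! z : P, x ⋖ z)

/-- `l` is a directed path from `y` to `z` in the cover graph of `P` (edges directed upwards). -/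
def IsDirectedPath {P : Type*} [PartialOrder P] (y z : P) (l : List P) : Prop :=
  l.IsChain (fun u v => u ⋖ v) ∧ l.head? = some y ∧ l.getLast? = some z

/-- A doubly irreducible element `x` is retractible if it does not lie as `y ⋖ x ⋖ z` between
two reducible (that is, not doubly irreducible) elements, or if it does, and `y ⋖ x ⋖ z` is
the only directed path from `y` to `z`. -/
def Retractible {P : Type*} [PartialOrder P] (x : P) : Prop :=
  DoublyIrr x ∧
    ((¬ ∃ y z : P, ¬ DoublyIrr y ∧ ¬ DoublyIrr z ∧ y ⋖ x ∧ x ⋖ z) ∨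
      (∃ y z : P, ¬ DoublyIrr y ∧ ¬ DoublyIrr z ∧ y ⋖ x ∧ x ⋖ z ∧
        ∀ l : List P, IsDirectedPath y z l → l = [y, x, z]))

/-- A basic retract: no element of `Irr*(P)` is retractible. -/
def IsBasicRetract (P : Type*) [PartialOrder P] : Prop :=
  ∀ x : P, IrrStar x → ¬ Retractible x

/-- A pendant vertex: a vertex of degree one of the cover graph. -/
def IsPendant {P : Type*} [PartialOrder P] (x : P) : Prop :=
  ((SimpleGraph.hasse P).neighborSet x).ncard = 1

/-- `T` arises from the subposet `S` of `P` by removing one element of `Irr*(S)` that is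
retractible in `S`. -/
def RetractStep {P : Type*} [PartialOrder P] (S T : Set P) : Prop :=
  ∃ x : S, IrrStar x ∧ Retractible x ∧ T = S \ {(x : P)}

/-- `T` arises from the subposet `S` of `P` by removing one pendant vertex of `S`. -/
def PendantStep {P : Type*} [PartialOrder P] (S T : Set P) : Prop :=
  ∃ x : S, IsPendant x ∧ T = S \ {(x : P)}

/-- `B` is (up to isomorphism) the basic block associated to the poset `P`: successively remove
retractible elements of `Irr*` from `P` until a basic retract `S` is reached, then successively
remove pendant vertices until none is left. -/
def IsAssociatedBasicBlock (B P : Type*) [PartialOrder B] [PartialOrder P] : Prop :=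
  ∃ S T : Set P,
    Relation.ReflTransGen RetractStep Set.univ S ∧ IsBasicRetract S ∧
    Relation.ReflTransGen PendantStep S T ∧ (∀ x : T, ¬ IsPendant x) ∧
    Nonempty (B ≃o T)

/-- The nullity of a finite poset: (edges) - (vertices) + (connected components) of its
cover graph. -/
noncomputable def nullity (P : Type*) [PartialOrder P] : ℤ :=
  ((SimpleGraph.hasse P).edgeSet.ncard : ℤ) - (Nat.card P : ℤ)
    + (Nat.card (SimpleGraph.hasse P).ConnectedComponent : ℤ)

/-! ### Lattices: reducible elements and blocks -/

/-- `a` is meet-reducible: `a = b ⊓ c` with `b`, `c` both distinct from `a`. -/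
def MeetReducible {L : Type*} [Lattice L] (a : L) : Prop :=
  ∃ b c : L, b ≠ a ∧ c ≠ a ∧ b ⊓ c = a

/-- `a` is join-reducible: `a = b ⊔ c` with `b`, `c` both distinct from `a`. -/
def JoinReducible {L : Type*} [Lattice L] (a : L) : Prop :=
  ∃ b c : L, b ≠ a ∧ c ≠ a ∧ b ⊔ c = a

/-- The set of reducible elements of a lattice. -/
def latticeRed (L : Type*) [Lattice L] : Set L :=
  {a | MeetReducible a ∨ JoinReducible a}

/-- A block: the smallest element is meet-reducible and the largest one is join-reducible. -/
def IsBlock (L : Type*) [Lattice L] : Prop :=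
  (∃ x : L, IsBot x ∧ MeetReducible x) ∧ (∃ x : L, IsTop x ∧ JoinReducible x)

/-- `L` is a block with exactly `r` reducible elements, pairwise comparable, with nullity `k`,
and `B` is the basic block associated to `L`. -/
def IsBlockOfType (B : Type*) [PartialOrder B] (r k : ℕ) (L : Type*) [Lattice L] : Prop :=
  IsBlock L ∧ (latticeRed L).ncard = r ∧ IsChain (· ≤ ·) (latticeRed L) ∧
    nullity L = (k : ℤ) ∧ IsAssociatedBasicBlock B L

/-- Lattice structures on `j` labelled elements which are blocks of the given type. -/
def LabelledBlock (B : Type*) [PartialOrder B] (j r k : ℕ) : Type :=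
  {L : Lattice (Fin j) // @IsBlockOfType B _ r k (Fin j) L}

/-- Isomorphism of lattices (as ordered sets). -/
def labelledBlockSetoid (B : Type*) [PartialOrder B] (j r k : ℕ) :
    Setoid (LabelledBlock B j r k) where
  r L M := Nonempty (@OrderIso (Fin j) (Fin j) L.1.toLE M.1.toLE)
  iseqv :=
    { refl := fun L => ⟨@OrderIso.refl (Fin j) L.1.toLE⟩
      symm := fun {L M} ⟨e⟩ => ⟨@OrderIso.symm (Fin j) (Fin j) L.1.toLE M.1.toLE e⟩
      trans := fun {L M N} ⟨e⟩ ⟨f⟩ =>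
        ⟨@OrderIso.trans (Fin j) (Fin j) (Fin j) L.1.toLE M.1.toLE N.1.toLE e f⟩ }

/-- The number, up to isomorphism, of blocks on `j` elements with exactly `r` reducible elements,
all comparable, of nullity `k`, whose associated basic block is `B`. -/
noncomputable def numBlocks (B : Type*) [PartialOrder B] (j r k : ℕ) : ℕ :=
  Nat.card (Quotient (labelledBlockSetoid B j r k))

/-! ### The basic blocks -/

/-- A pair `(a, b)` with `a < b`, `b` not covering `a`, in the chain `0 ⋖ 1 ⋖ ⋯ ⋖ n - 1`. -/
abbrev AdjunctPair (n : ℕ) : Type := {q : Fin n × Fin n // (q.1 : ℕ) + 1 < (q.2 : ℕ)}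

/-- The adjunct `C ]_{a₀}^{b₀} {c₀} ]_{a₁}^{b₁} {c₁} ⋯ ]_{a_{m-1}}^{b_{m-1}} {c_{m-1}}` of the
`n`-element chain `C` with `m` one-element chains at the pairs `p k = (a_k, b_k)` of elements
of `C`. -/
inductive ChainAdjunct {n m : ℕ} (p : Fin m → AdjunctPair n) : Type
  /-- an element of the chain `C` -/
  | base (x : Fin n) : ChainAdjunct p
  /-- the new element `c_k`, placed between `a_k` and `b_k` -/
  | new (k : Fin m) : ChainAdjunct p

/-- The order of the adjunct: `c_k` is above exactly what is below `a_k`, and below exactly what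
is above `b_k`. -/
def ChainAdjunct.le {n m : ℕ} {p : Fin m → AdjunctPair n} :
    ChainAdjunct p → ChainAdjunct p → Prop
  | .base x, .base y => x ≤ y
  | .base x, .new k => x ≤ (p k).1.1
  | .new k, .base y => (p k).1.2 ≤ y
  | .new k, .new l => k = l ∨ (p k).1.2 ≤ (p l).1.1

instance chainAdjunctPartialOrder {n m : ℕ} (p : Fin m → AdjunctPair n) : PartialOrder (ChainAdjunct p) where
  le := ChainAdjunct.le
  le_refl x := by cases x <;> simp [ChainAdjunct.le]
  le_trans x y z hxy hyz := by
    rcases x with x | x <;> rcases y with y | y <;> rcases z with z | z <;>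
      simp only [ChainAdjunct.le, Fin.le_def] at hxy hyz ⊢
    · omega
    · omega
    · have := (p y).2
      omega
    · rcases hyz with rfl | h
      · exact hxy
      · have := (p y).2
        omega
    · omega
    · right
      omega
    · rcases hxy with rfl | h
      · exact hyz
      · have := (p y).2
        omega
    · rcases hxy with rfl | h
      · exact hyz
      · rcases hyz with rfl | h'
        · exact Or.inr h
        · have := (p y).2
          right
          omega
  le_antisymm x y hxy hyx := by
    rcases x with x | x <;> rcases y with y | y <;>
      simp only [ChainAdjunct.le, Fin.le_def] at hxy hyx
    · congr 1
      exact Fin.ext (by omega)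
    · have := (p y).2
      omega
    · have := (p x).2
      omega
    · rcases hxy with rfl | h
      · rfl
      · rcases hyx with rfl | h'
        · rfl
        · have := (p x).2
          have := (p y).2
          omega

/-- `B₆ = C ]_a^1 {c₁} ]_b^1 {c₂} ]_0^b {c₃}`, where `C : 0 ⋖ a ⋖ b ⋖ y ⋖ 1`. -/
def pairsB6 : Fin 3 → AdjunctPair 5 :=
  ![⟨(1, 4), by decide⟩, ⟨(2, 4), by decide⟩, ⟨(0, 2), by decide⟩]

/-- `B₇`, the dual of `B₆`: `C ]_0^b {c₁} ]_0^a {c₂} ]_a^1 {c₃}`,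
where `C : 0 ⋖ y ⋖ a ⋖ b ⋖ 1`. -/
def pairsB7 : Fin 3 → AdjunctPair 5 :=
  ![⟨(0, 3), by decide⟩, ⟨(0, 2), by decide⟩, ⟨(2, 4), by decide⟩]

/-- `B₈ = C ]_a^1 {c₁} ]_b^1 {c₂} ]_0^1 {c₃}`, where `C : 0 ⋖ a ⋖ b ⋖ y ⋖ 1`. -/
def pairsB8 : Fin 3 → AdjunctPair 5 :=
  ![⟨(1, 4), by decide⟩, ⟨(2, 4), by decide⟩, ⟨(0, 4), by decide⟩]

/-- `B₉`, the dual of `B₈`: `C ]_0^b {c₁} ]_0^a {c₂} ]_0^1 {c₃}`,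
where `C : 0 ⋖ y ⋖ a ⋖ b ⋖ 1`. -/
def pairsB9 : Fin 3 → AdjunctPair 5 :=
  ![⟨(0, 3), by decide⟩, ⟨(0, 2), by decide⟩, ⟨(0, 4), by decide⟩]

/-- `B₁₀ = C ]_a^b {c₁} ]_0^b {c₂} ]_0^1 {c₃}`, where `C : 0 ⋖ a ⋖ x ⋖ b ⋖ 1`. -/
def pairsB10 : Fin 3 → AdjunctPair 5 :=
  ![⟨(1, 3), by decide⟩, ⟨(0, 3), by decide⟩, ⟨(0, 4), by decide⟩]

/-- `B₁₁`, the dual of `B₁₀`: `C ]_a^b {c₁} ]_a^1 {c₂} ]_0^1 {c₃}`,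
where `C : 0 ⋖ a ⋖ x ⋖ b ⋖ 1`. -/
def pairsB11 : Fin 3 → AdjunctPair 5 :=
  ![⟨(1, 3), by decide⟩, ⟨(1, 4), by decide⟩, ⟨(0, 4), by decide⟩]

/-- `B₁₂ = C ]_a^b {c₁} ]_a^1 {c₂} ]_0^b {c₃}`, where `C : 0 ⋖ a ⋖ x ⋖ b ⋖ 1`. -/
def pairsB12 : Fin 3 → AdjunctPair 5 :=
  ![⟨(1, 3), by decide⟩, ⟨(1, 4), by decide⟩, ⟨(0, 3), by decide⟩]

/-! ### Partition numbers -/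

/-- The number of partitions of `n` into exactly `k` positive parts. -/
noncomputable def partitionNumber (k n : ℕ) : ℕ :=
  Nat.card {q : Nat.Partition n // q.parts.card = k}

/-! In a finite poset, the retractible elements with one lower and one upper cover are exactly those
that subdivide a cover: `x` is such an element iff it is inserted into a pair `y < z` that becomes a
cover once `x` is deleted (`exists_insertedAt_iff`). Undoing a retraction therefore means
subdividing an edge of the cover graph.

Each of the seven basic blocks consists of four vertices `0 < 1 < 2 < 3`, its reducible elements,
joined by six chains. Two of these chains are parallel (edges `4` and `5`). The edges `2` and `3`
skip a vertex, and `0` and `1` join consecutive vertices with nothing in between. Subdividing a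
cover lengthens one of the six chains by one, so the posets that retract to the basic block are
those `glued` from chains of sizes `n k`, with `n 0, n 1 ≥ 0` and the other sizes at least `1`
(`exists_glued_of_isBlockOfType`). Pendant vertices never interfere, because retraction keeps two
covers at the bottom and at the top. Conversely, every such glued poset is a lattice, has the four
vertices as its reducible elements, has `6 + ∑ n k` covers and `4 + ∑ n k` elements, hence nullity
three, and retracts to the basic block (`isBlockOfType_of_glued`).

An isomorphism fixes the four vertices, so it preserves the chain sizes up to exchanging the two
parallel chains (`sizes_eq`). The number of blocks is thus the number of size vectors with `n 4 ≤ n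
5` and `4 + ∑ n k = j`, whichever of the seven shapes is taken. With `t = n 0 + 1`, `r = n 1 + 1`,
`l = n 2`, `i = n 3`, the remaining pair is a partition of `j - t - r - l - i - 2` into two parts,
which gives the sum (`card_sortedSizes`). -/

/-! ### Retractible elements in order-theoretic terms -/

/-- `x` is inserted into the pair `y < z`: it lies alone between `y` and `z`, everything below `x`
is below `y`, and everything above `x` is above `z`. -/
structure InsertedAt {P : Type*} [PartialOrder P] (x y z : P) : Prop where
  left : y < x
  right : x < z
  below : ∀ w, w < x → w ≤ y
  above : ∀ w, x < w → z ≤ w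
  alone : ∀ w, y < w → w < z → w = x

section Finite

variable {P : Type*} [PartialOrder P]

lemma InsertedAt.covBy_left {x y z : P} (h : InsertedAt x y z) : y ⋖ x :=
  ⟨h.left, fun w hy hx => (h.below w hx).not_gt hy⟩

lemma InsertedAt.covBy_right {x y z : P} (h : InsertedAt x y z) : x ⋖ z :=
  ⟨h.right, fun w hx hz => (h.above w hx).not_gt hz⟩

lemma InsertedAt.eq_of_covBy_left {x y z w : P} (h : InsertedAt x y z) (hw : w ⋖ x) : w = y := by
  by_contra hne
  exact hw.2 (lt_of_le_of_ne (h.below w hw.1) hne) h.left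

lemma InsertedAt.eq_of_covBy_right {x y z w : P} (h : InsertedAt x y z) (hw : x ⋖ w) : w = z := by
  by_contra hne
  exact hw.2 h.right (lt_of_le_of_ne (h.above w hw.1) (Ne.symm hne))

lemma InsertedAt.irrStar {x y z : P} (h : InsertedAt x y z) : IrrStar x :=
  ⟨⟨y, h.covBy_left, fun _ => h.eq_of_covBy_left⟩, ⟨z, h.covBy_right, fun _ => h.eq_of_covBy_right⟩⟩

lemma InsertedAt.doublyIrr {x y z : P} (h : InsertedAt x y z) : DoublyIrr x :=
  ⟨fun _ _ h₁ h₂ => (h.eq_of_covBy_left h₁).trans (h.eq_of_covBy_left h₂).symm,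
    fun _ _ h₁ h₂ => (h.eq_of_covBy_right h₁).trans (h.eq_of_covBy_right h₂).symm⟩

lemma le_of_isDirectedPath : ∀ {l : List P} {y z : P}, IsDirectedPath y z l → y ≤ z
  | [], _, _, h => by simp [IsDirectedPath] at h
  | [a], y, z, h => by
      obtain ⟨-, h₁, h₂⟩ := h
      simp at h₁ h₂
      exact (h₁.symm.trans h₂).le
  | a :: b :: l, y, z, h => by
      obtain ⟨h₀, h₁, h₂⟩ := h
      simp only [List.head?_cons, Option.some.injEq] at h₁
      rw [List.isChain_cons_cons] at h₀
      have : b ≤ z := le_of_isDirectedPath ⟨h₀.2, rfl, by simpa using h₂⟩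
      exact h₁ ▸ h₀.1.1.le.trans this

lemma exists_isDirectedPath [Finite P] {y z : P} (h : y ≤ z) :
    ∃ l : List P, IsDirectedPath y z l := by
  induction y using WellFoundedGT.induction with
  | ind y ih =>
    rcases h.eq_or_lt with rfl | h
    · exact ⟨[y], by simp [IsDirectedPath]⟩
    · obtain ⟨u, hu, huz⟩ := exists_covBy_le_of_lt h
      obtain ⟨l, hl⟩ := ih u hu.1 huz
      refine ⟨y :: l, ?_, rfl, ?_⟩
      · rw [List.isChain_cons]
        refine ⟨fun v hv => ?_, hl.1⟩
        rw [hl.2.1] at hv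
        simp at hv
        exact hv ▸ hu
      · rw [List.getLast?_cons, hl.2.2]
        rfl

/-- The second node of the path lies in `(y, z]`. It is not `z`, since `x` separates `y` from `z`,
so it is `x`. The only upper cover of `x` is `z`, and the path cannot climb beyond its end. -/
lemma InsertedAt.eq_of_isDirectedPath {x y z : P} (h : InsertedAt x y z) {l : List P}
    (hl : IsDirectedPath y z l) : l = [y, x, z] := by
  match l, hl with
  | [], hl => simp [IsDirectedPath] at hl
  | [a], ⟨_, h₁, h₂⟩ =>
    simp at h₁ h₂
    exact absurd (h₁.symm.trans h₂) (h.left.trans h.right).ne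
  | a :: b :: l, ⟨h₀, h₁, h₂⟩ =>
    simp only [List.head?_cons, Option.some.injEq] at h₁
    subst h₁
    rw [List.isChain_cons_cons] at h₀
    have hbz : b ≤ z := le_of_isDirectedPath ⟨h₀.2, rfl, by simpa using h₂⟩
    have hb : b = x := by
      refine h.alone b h₀.1.1 (lt_of_le_of_ne hbz ?_)
      rintro rfl
      exact h₀.1.2 h.left h.right
    subst hb
    match l, h₀.2, h₂ with
    | [], _, h₂ =>
      simp at h₂
      exact absurd h₂ h.right.ne
    | c :: l, h₀, h₂ =>
      rw [List.isChain_cons_cons] at h₀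
      obtain rfl := h.eq_of_covBy_right h₀.1
      match l, h₀.2, h₂ with
      | [], _, _ => rfl
      | d :: l, h₀, h₂ =>
        rw [List.isChain_cons_cons] at h₀
        have : d ≤ c := le_of_isDirectedPath ⟨h₀.2, rfl, by simpa using h₂⟩
        exact absurd this h₀.1.1.not_ge

lemma InsertedAt.retractible {x y z : P} (h : InsertedAt x y z) : Retractible x := by
  refine ⟨h.doublyIrr, ?_⟩
  by_cases hr : ∃ y z : P, ¬ DoublyIrr y ∧ ¬ DoublyIrr z ∧ y ⋖ x ∧ x ⋖ z
  · right
    obtain ⟨y', z', hy, hz, h₁, h₂⟩ := hr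
    obtain rfl := h.eq_of_covBy_left h₁
    obtain rfl := h.eq_of_covBy_right h₂
    exact ⟨y', z', hy, hz, h₁, h₂, fun l => h.eq_of_isDirectedPath⟩
  · exact Or.inl hr

/-- This replaces reducible neighbours and directed paths by a purely order-theoretic condition. For
the converse, let `y ⋖ x ⋖ z` be the unique covers. If `y` is doubly irreducible, everything above
`y` is above `x`, and dually for `z`; if both are reducible, a second element between them would
give a second path. -/
lemma exists_insertedAt_iff [Finite P] {x : P} :
    (∃ y z, InsertedAt x y z) ↔ IrrStar x ∧ Retractible x := by
  refine ⟨fun ⟨y, z, h⟩ => ⟨h.irrStar, h.retractible⟩, ?_⟩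
  rintro ⟨⟨⟨y, hy, hy'⟩, ⟨z, hz, hz'⟩⟩, hd, hr⟩
  have below : ∀ w, w < x → w ≤ y := fun w hw => by
    obtain ⟨u, hwu, hu⟩ := exists_le_covBy_of_lt hw
    exact hy' u hu ▸ hwu
  have above : ∀ w, x < w → z ≤ w := fun w hw => by
    obtain ⟨u, hu, hwu⟩ := exists_covBy_le_of_lt hw
    exact hz' u hu ▸ hwu
  refine ⟨y, z, hy.1, hz.1, below, above, fun w hyw hwz => ?_⟩
  have ge : x ≤ w → w = x := fun h =>
    (h.eq_or_lt).elim Eq.symm fun h => absurd hwz (above w h).not_gt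
  have le : w ≤ x → w = x := fun h =>
    (h.eq_or_lt).elim id fun h => absurd hyw (below w h).not_gt
  obtain ⟨u, hu, huw⟩ := exists_covBy_le_of_lt hyw
  obtain ⟨v, hwv, hv⟩ := exists_le_covBy_of_lt hwz
  rcases hr with hr | ⟨y', z', -, -, hy₁, hz₁, hp⟩
  · by_cases hyd : DoublyIrr y
    · exact ge (hyd.2 u x hu hy ▸ huw)
    · by_cases hzd : DoublyIrr z
      · exact le (hzd.1 v x hv hz ▸ hwv)
      · exact absurd ⟨y, z, hyd, hzd, hy, hz⟩ hr
  · obtain rfl := hy' y' hy₁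
    obtain rfl := hz' z' hz₁
    obtain ⟨l, hl⟩ := exists_isDirectedPath (huw.trans hwz.le)
    -- The path through `u ⋖ ... ⋖ z` must be the only one, so `u = x` and hence `x ≤ w`.
    have := hp (y' :: l) ⟨by
      rw [List.isChain_cons]
      refine ⟨fun v hv => ?_, hl.1⟩
      rw [hl.2.1] at hv
      simp at hv
      exact hv ▸ hu, rfl, by rw [List.getLast?_cons, hl.2.2]; rfl⟩
    simp only [List.cons.injEq, true_and] at this
    have h₁ := hl.2.1
    rw [this] at h₁
    simp at h₁
    exact ge (h₁ ▸ huw)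

lemma InsertedAt.map {Q : Type*} [PartialOrder Q] (φ : P ≃o Q) {x y z : P}
    (h : InsertedAt x y z) : InsertedAt (φ x) (φ y) (φ z) where
  left := φ.lt_iff_lt.2 h.left
  right := φ.lt_iff_lt.2 h.right
  below w hw := by
    rw [← φ.apply_symm_apply w, φ.lt_iff_lt] at hw
    rw [← φ.apply_symm_apply w, φ.le_iff_le]
    exact h.below _ hw
  above w hw := by
    rw [← φ.apply_symm_apply w, φ.lt_iff_lt] at hw
    rw [← φ.apply_symm_apply w, φ.le_iff_le]
    exact h.above _ hw
  alone w hw hw' := by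
    rw [← φ.apply_symm_apply w, φ.lt_iff_lt] at hw hw'
    rw [← φ.apply_symm_apply w, h.alone _ hw hw']

lemma InsertedAt.le_iff {x y z w : P} (h : InsertedAt x y z) (hw : w ≠ x) : w ≤ x ↔ w ≤ y :=
  ⟨fun hx => h.below w (lt_of_le_of_ne hx hw), fun hy => hy.trans h.left.le⟩

lemma InsertedAt.ge_iff {x y z w : P} (h : InsertedAt x y z) (hw : w ≠ x) : x ≤ w ↔ z ≤ w :=
  ⟨fun hx => h.above w (lt_of_le_of_ne hx hw.symm), fun hz => h.right.le.trans hz⟩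

lemma bijective_option_elim {Q T : Type*} {k : Q → T} (hk : Function.Injective k) {t : T}
    (ht : Set.range k = {t}ᶜ) : Function.Bijective (fun o : Option Q => o.elim t k) := by
  have hkt : ∀ q, k q ≠ t := fun q => by simpa [ht] using Set.mem_range_self (f := k) q
  constructor
  · rintro (_ | a) (_ | b) hab
    · rfl
    · exact absurd hab.symm (hkt b)
    · exact absurd hab (hkt a)
    · exact congrArg some (hk hab)
  · intro u
    by_cases hu : u = t
    · exact ⟨none, hu.symm⟩
    · have : u ∈ Set.range k := by rw [ht]; exact hu
      obtain ⟨q, hq⟩ := this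
      exact ⟨some q, hq⟩

/-- A poset obtained by inserting one element into a pair of `Q` is determined by the pair. -/
lemma nonempty_orderIso_of_insertedAt {Q R : Type*} [PartialOrder Q] [PartialOrder R]
    (f : Q ↪o P) (g : Q ↪o R) {x : P} {x' : R} (hf : Set.range f = {x}ᶜ) (hg : Set.range g = {x'}ᶜ)
    {y z : Q} (h : InsertedAt x (f y) (f z)) (h' : InsertedAt x' (g y) (g z)) :
    Nonempty (P ≃o R) := by
  have hfx : ∀ q, f q ≠ x := fun q => by simpa [hf] using Set.mem_range_self (f := f) q
  have hgx : ∀ q, g q ≠ x' := fun q => by simpa [hg] using Set.mem_range_self (f := g) q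
  -- Both posets are `Q` with one extra point, modelled on `Option Q`; the comparisons with the
  -- extra point are dictated by `y` and `z`.
  let F := Equiv.ofBijective _ (bijective_option_elim f.injective hf)
  let G := Equiv.ofBijective _ (bijective_option_elim g.injective hg)
  refine ⟨⟨F.symm.trans G, ?_⟩⟩
  intro a b
  obtain ⟨a, rfl⟩ := F.surjective a
  obtain ⟨b, rfl⟩ := F.surjective b
  simp only [Equiv.trans_apply, Equiv.symm_apply_apply]
  rcases a with _ | a <;> rcases b with _ | b
  · exact iff_of_true le_rfl le_rfl
  · change x' ≤ g b ↔ x ≤ f b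
    rw [h'.ge_iff (hgx b), h.ge_iff (hfx b), g.le_iff_le, f.le_iff_le]
  · change g a ≤ x' ↔ f a ≤ x
    rw [h'.le_iff (hgx a), h.le_iff (hfx a), g.le_iff_le, f.le_iff_le]
  · change g a ≤ g b ↔ f a ≤ f b
    rw [g.le_iff_le, f.le_iff_le]

end Finite

/-! ### The ends of a block, and pendant vertices -/

section Ends

variable {P Q : Type*} [PartialOrder P] [PartialOrder Q]

/-- There is a least element, and it has two upper covers. -/
def BranchingBot (P : Type*) [PartialOrder P] : Prop :=
  ∃ b : P, IsBot b ∧ ∃ u v, u ≠ v ∧ b ⋖ u ∧ b ⋖ v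

lemma InsertedAt.dual {x y z : P} (h : InsertedAt x y z) :
    InsertedAt (OrderDual.toDual x) (OrderDual.toDual z) (OrderDual.toDual y) where
  left := h.right
  right := h.left
  below w hw := h.above (OrderDual.ofDual w) hw
  above w hw := h.below (OrderDual.ofDual w) hw
  alone w hw hw' := h.alone (OrderDual.ofDual w) hw' hw

/-- The bottom is not `x`, as `f y < x`. A cover of the bottom survives the deletion of `x`, except
that `x` itself is replaced by `z`. Two distinct covers could only merge if they were `x` and `f z`,
but `f z` does not cover `f y` while `x` lies between them. -/
lemma BranchingBot.of_insertedAt (f : Q ↪o P) {x : P} (hf : Set.range f = {x}ᶜ) {y z : Q}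
    (h : InsertedAt x (f y) (f z)) (hP : BranchingBot P) : BranchingBot Q := by
  have lift : ∀ w, w ≠ x → ∃ q, f q = w := fun w hw => by
    have : w ∈ Set.range f := by rw [hf]; exact hw
    exact this
  obtain ⟨b, hb, u, v, huv, hu, hv⟩ := hP
  obtain ⟨b, rfl⟩ := lift b (fun hbx => (hb (f y)).not_gt (hbx ▸ h.left))
  have key : ∀ w, f b ⋖ w → ∃ w', b ⋖ w' ∧ (f w' = w ∨ w = x ∧ w' = z ∧ b = y) := by
    intro w hw
    by_cases hwx : w = x
    · subst hwx
      have hby : b = y := f.injective (h.eq_of_covBy_left hw)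
      subst hby
      refine ⟨z, ⟨f.lt_iff_lt.1 (h.left.trans h.right), fun c hc hc' => ?_⟩, Or.inr ⟨rfl, rfl, rfl⟩⟩
      have hc0 := h.alone (f c) (f.lt_iff_lt.2 hc) (f.lt_iff_lt.2 hc')
      have := Set.mem_range_self (f := f) c
      rw [hf] at this
      exact this hc0
    · obtain ⟨w, rfl⟩ := lift w hwx
      exact ⟨w, ⟨f.lt_iff_lt.1 hw.1, fun c hc hc' => hw.2 (f.lt_iff_lt.2 hc) (f.lt_iff_lt.2 hc')⟩,
        Or.inl rfl⟩
  obtain ⟨u', hu', hu''⟩ := key u hu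
  obtain ⟨v', hv', hv''⟩ := key v hv
  refine ⟨b, fun q => f.le_iff_le.1 (hb (f q)), u', v', ?_, hu', hv'⟩
  rintro rfl
  rcases hu'' with rfl | ⟨rfl, rfl, rfl⟩ <;> rcases hv'' with rfl | ⟨rfl, hz, hy⟩
  · exact huv rfl
  · subst hz hy
    exact hu.2 h.left h.right
  · exact hv.2 h.left h.right
  · exact huv rfl

lemma BranchingBot.dual_of_insertedAt (f : Q ↪o P) {x : P} (hf : Set.range f = {x}ᶜ) {y z : Q}
    (h : InsertedAt x (f y) (f z)) (hP : BranchingBot Pᵒᵈ) : BranchingBot Qᵒᵈ :=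
  hP.of_insertedAt f.dual (x := OrderDual.toDual x) hf (y := OrderDual.toDual z)
    (z := OrderDual.toDual y) h.dual

lemma not_isPendant_of_adj {x u v : P} (huv : u ≠ v) (hu : (SimpleGraph.hasse P).Adj x u)
    (hv : (SimpleGraph.hasse P).Adj x v) : ¬ IsPendant x := by
  intro h
  obtain ⟨a, ha⟩ := Set.ncard_eq_one.1 h
  have h₁ : u ∈ (SimpleGraph.hasse P).neighborSet x := hu
  have h₂ : v ∈ (SimpleGraph.hasse P).neighborSet x := hv
  rw [ha] at h₁ h₂
  exact huv (h₁.trans h₂.symm)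

/-- The two ends have two neighbours by assumption; any other element has a lower cover and an upper
cover. -/
lemma not_isPendant_of_branching [Finite P] (h₀ : BranchingBot P) (h₁ : BranchingBot Pᵒᵈ) (x : P) :
    ¬ IsPendant x := by
  obtain ⟨b, hb, u, v, huv, hu, hv⟩ := h₀
  obtain ⟨t, ht, u', v', huv', hu', hv'⟩ := h₁
  obtain ⟨t, rfl⟩ := OrderDual.toDual.surjective t
  obtain ⟨u', rfl⟩ := OrderDual.toDual.surjective u'
  obtain ⟨v', rfl⟩ := OrderDual.toDual.surjective v'
  rw [toDual_covBy_toDual_iff] at hu' hv'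
  by_cases hxb : x = b
  · subst hxb
    exact not_isPendant_of_adj huv (Or.inl hu) (Or.inl hv)
  by_cases hxt : x = t
  · subst hxt
    exact not_isPendant_of_adj (fun h => huv' (congrArg _ h)) (Or.inr hu') (Or.inr hv')
  · obtain ⟨c, -, hc⟩ := exists_le_covBy_of_lt (lt_of_le_of_ne (hb x) (Ne.symm hxb))
    obtain ⟨d, hd, -⟩ := exists_covBy_le_of_lt
      (lt_of_le_of_ne (OrderDual.toDual_le_toDual.1 (ht (OrderDual.toDual x))) hxt)
    exact not_isPendant_of_adj (hc.1.trans hd.1).ne (Or.inr hc) (Or.inl hd)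

end Ends

/-! ### One retraction step -/

lemma range_inclusion_diff_singleton {P : Type*} {S : Set P} (x : S) :
    Set.range (Set.inclusion (Set.sdiff_subset : S \ {(x : P)} ⊆ S)) = {x}ᶜ := by
  ext w
  simp [Set.range_inclusion, Subtype.ext_iff]

/-- The inclusion of a subset, as an order embedding. -/
def inclusionEmbedding {P : Type*} [PartialOrder P] {S T : Set P} (h : T ⊆ S) : T ↪o S where
  toFun := Set.inclusion h
  inj' := Set.inclusion_injective h
  map_rel_iff' := Iff.rfl

lemma RetractStep.exists_insertedAt {P : Type*} [PartialOrder P] [Finite P] {S T : Set P}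
    (h : RetractStep S T) : ∃ (f : T ↪o S) (x : S) (y z : T),
      Set.range f = {x}ᶜ ∧ InsertedAt x (f y) (f z) := by
  obtain ⟨x, hx, hr, rfl⟩ := h
  obtain ⟨y, z, h⟩ := exists_insertedAt_iff.2 ⟨hx, hr⟩
  refine ⟨inclusionEmbedding Set.sdiff_subset, x, ⟨y, y.2, fun e => h.left.ne (Subtype.ext e)⟩,
    ⟨z, z.2, fun e => h.right.ne (Subtype.ext e).symm⟩, range_inclusion_diff_singleton x, h⟩

lemma InsertedAt.retractStep {P : Type*} [PartialOrder P] {S : Set P} {x y z : S}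
    (h : InsertedAt x y z) : RetractStep S (S \ {(x : P)}) :=
  ⟨x, h.irrStar, h.retractible, rfl⟩

lemma isBasicRetract_iff {P : Type*} [PartialOrder P] [Finite P] :
    IsBasicRetract P ↔ ∀ x y z : P, ¬ InsertedAt x y z :=
  ⟨fun h x y z hx => h x hx.irrStar hx.retractible, fun h x hx hr => by
    obtain ⟨y, z, h'⟩ := exists_insertedAt_iff.2 ⟨hx, hr⟩
    exact h x y z h'⟩

/-- Pendant vertices play no role in a poset obtained by retraction from one whose ends branch. -/
lemma branching_of_retract {P : Type*} [PartialOrder P] [Finite P] {S T : Set P}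
    (h : Relation.ReflTransGen RetractStep S T) (h₀ : BranchingBot S) (h₁ : BranchingBot Sᵒᵈ) :
    BranchingBot T ∧ BranchingBot Tᵒᵈ := by
  induction h with
  | refl => exact ⟨h₀, h₁⟩
  | tail _ hs ih =>
    obtain ⟨f, x, y, z, hf, hx⟩ := hs.exists_insertedAt
    exact ⟨ih.1.of_insertedAt f hf hx, ih.2.dual_of_insertedAt f hf hx⟩

lemma eq_of_pendantSteps {P : Type*} [PartialOrder P] {S T : Set P}
    (h : Relation.ReflTransGen PendantStep S T) (hS : ∀ x : S, ¬ IsPendant x) : S = T := by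
  rcases Relation.ReflTransGen.cases_head h with h | ⟨U, ⟨x, hx, -⟩, -⟩
  · exact h
  · exact absurd hx (hS x)

/-! ### Reducible elements of finite lattices -/

section Lattice

variable {L : Type*} [Lattice L] [Finite L]

/-- Expressing reducibility through covers ties the lattice notion to `DoublyIrr`, which is the
notion used by retraction. -/
lemma meetReducible_iff {a : L} : MeetReducible a ↔ ∃ u v, u ≠ v ∧ a ⋖ u ∧ a ⋖ v := by
  constructor
  · rintro ⟨b, c, hb, hc, rfl⟩
    obtain ⟨u, hu, hub⟩ := exists_covBy_le_of_lt (lt_of_le_of_ne inf_le_left hb.symm)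
    obtain ⟨v, hv, hvc⟩ := exists_covBy_le_of_lt (lt_of_le_of_ne inf_le_right hc.symm)
    refine ⟨u, v, ?_, hu, hv⟩
    rintro rfl
    exact (le_inf hub hvc).not_gt hu.1
  · rintro ⟨u, v, huv, hu, hv⟩
    refine ⟨u, v, hu.1.ne', hv.1.ne', ?_⟩
    rcases hu.eq_or_eq (le_inf hu.1.le hv.1.le) inf_le_left with h | h
    · exact h
    · rcases hv.eq_or_eq hu.1.le (inf_eq_left.1 h) with h | h
      · exact absurd h hu.1.ne'
      · exact absurd h huv

lemma joinReducible_iff {a : L} : JoinReducible a ↔ ∃ u v, u ≠ v ∧ u ⋖ a ∧ v ⋖ a := by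
  have : JoinReducible a ↔ MeetReducible (OrderDual.toDual a) := Iff.rfl
  rw [this, meetReducible_iff]
  constructor
  · rintro ⟨u, v, huv, hu, hv⟩
    exact ⟨OrderDual.ofDual u, OrderDual.ofDual v, huv, hu.ofDual, hv.ofDual⟩
  · rintro ⟨u, v, huv, hu, hv⟩
    exact ⟨OrderDual.toDual u, OrderDual.toDual v, huv, hu.toDual, hv.toDual⟩

lemma mem_latticeRed_iff {a : L} : a ∈ latticeRed L ↔ ¬ DoublyIrr a := by
  change MeetReducible a ∨ JoinReducible a ↔ _
  rw [meetReducible_iff, joinReducible_iff, DoublyIrr, not_and_or]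
  push Not
  constructor
  · rintro (⟨u, v, h, h₁, h₂⟩ | ⟨u, v, h, h₁, h₂⟩)
    · exact Or.inr ⟨u, v, h₁, h₂, h⟩
    · exact Or.inl ⟨u, v, h₁, h₂, h⟩
  · rintro (⟨u, v, h₁, h₂, h⟩ | ⟨u, v, h₁, h₂, h⟩)
    · exact Or.inr ⟨u, v, h, h₁, h₂⟩
    · exact Or.inl ⟨u, v, h, h₁, h₂⟩

lemma isBlock_iff : IsBlock L ↔ BranchingBot L ∧ BranchingBot Lᵒᵈ := by
  have h : IsBlock L ↔ (∃ x : L, IsBot x ∧ MeetReducible x) ∧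
      ∃ x : Lᵒᵈ, IsBot x ∧ MeetReducible x := Iff.rfl
  simp only [h, meetReducible_iff, BranchingBot]

end Lattice

/-! ### Nullity -/

section Nullity

variable {P Q : Type*} [PartialOrder P] [PartialOrder Q]

/-- Isomorphic posets have isomorphic cover graphs. -/
def hasseIso (φ : P ≃o Q) : SimpleGraph.hasse P ≃g SimpleGraph.hasse Q where
  toEquiv := φ.toEquiv
  map_rel_iff' := by
    intro a b
    simp [SimpleGraph.hasse_adj]

lemma nullity_congr (φ : P ≃o Q) : nullity P = nullity Q := by
  unfold nullity
  rw [Nat.card_congr φ.toEquiv, Nat.card_congr (hasseIso φ).connectedComponentEquiv,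
    ← Nat.card_coe_set_eq, ← Nat.card_coe_set_eq, Nat.card_congr (hasseIso φ).mapEdgeSet]

lemma hasse_reachable_of_le [Finite P] {a b : P} (h : a ≤ b) :
    (SimpleGraph.hasse P).Reachable a b := by
  induction a using WellFoundedGT.induction with
  | ind a ih =>
    rcases h.eq_or_lt with rfl | h
    · rfl
    · obtain ⟨u, hu, hub⟩ := exists_covBy_le_of_lt h
      exact (SimpleGraph.Adj.reachable (Or.inl hu)).trans (ih u hu.1 hub)

lemma card_connectedComponent_hasse [Finite P] {b : P} (hb : IsBot b) :
    Nat.card (SimpleGraph.hasse P).ConnectedComponent = 1 := by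
  rw [Nat.card_eq_one_iff_unique]
  refine ⟨⟨fun c d => ?_⟩, ⟨(SimpleGraph.hasse P).connectedComponentMk b⟩⟩
  induction c using SimpleGraph.ConnectedComponent.ind with | _ c =>
  induction d using SimpleGraph.ConnectedComponent.ind with | _ d =>
  exact SimpleGraph.ConnectedComponent.sound
    ((hasse_reachable_of_le (hb c)).symm.trans (hasse_reachable_of_le (hb d)))

lemma ncard_edgeSet_hasse :
    (SimpleGraph.hasse P).edgeSet.ncard = {q : P × P | q.1 ⋖ q.2}.ncard := by
  have : (SimpleGraph.hasse P).edgeSet =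
      (fun q : P × P => s(q.1, q.2)) '' {q : P × P | q.1 ⋖ q.2} := by
    ext e
    induction e using Sym2.ind with | _ a b =>
    simp only [SimpleGraph.mem_edgeSet, SimpleGraph.hasse_adj, Set.mem_image, Set.mem_ofPred_eq,
      Prod.exists]
    constructor
    · rintro (h | h)
      · exact ⟨a, b, h, rfl⟩
      · exact ⟨b, a, h, Sym2.eq_swap⟩
    · rintro ⟨c, d, h, he⟩
      rcases Sym2.eq_iff.1 he with ⟨rfl, rfl⟩ | ⟨rfl, rfl⟩
      · exact Or.inl h
      · exact Or.inr h
  rw [this, Set.InjOn.ncard_image]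
  rintro ⟨a, b⟩ hab ⟨c, d⟩ hcd he
  rcases Sym2.eq_iff.1 he with ⟨rfl, rfl⟩ | ⟨rfl, rfl⟩
  · rfl
  · exact absurd hab.1 hcd.1.not_gt

end Nullity

/-! ### Posets of chains glued along a chain of four vertices -/

/-- Six edges between the vertices `0 < 1 < 2 < 3`. The edges `4` and `5` are parallel, and these
are the only parallel ones; the edges `0` and `1` join consecutive vertices, the edges `2` and `3`
do not; and every vertex is the source of two edges or the target of two edges. -/
structure Shape where
  /-- the lower end of an edge -/
  src : Fin 6 → ℕ
  /-- the upper end of an edge -/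
  tgt : Fin 6 → ℕ
  src_lt : ∀ k, src k < tgt k
  tgt_le : ∀ k, tgt k ≤ 3
  src_parallel : src 4 = src 5
  tgt_parallel : tgt 4 = tgt 5
  parallel : ∀ k l, k < l → src k = src l → tgt k = tgt l → k = 4 ∧ l = 5
  short_zero : tgt 0 = src 0 + 1
  short_one : tgt 1 = src 1 + 1
  long_two : src 2 + 1 < tgt 2
  long_three : src 3 + 1 < tgt 3
  consecutive : ∀ i < 3, ∃ k, src k = i ∧ tgt k = i + 1
  branching : ∀ i < 4, ∃ k l, k ≠ l ∧ (src k = i ∧ src l = i ∨ tgt k = i ∧ tgt l = i)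

/-- The vertices, and the potential inner elements of the chains along the edges. -/
inductive Node (s : Shape) : Type
  /-- a vertex -/
  | vert (i : ℕ) : Node s
  /-- an inner element of the chain along the edge `k` -/
  | mid (k : Fin 6) (m : ℕ) : Node s

namespace Node

variable {s : Shape}

/-- The largest vertex below a node. -/
def lo : Node s → ℕ
  | vert i => i
  | mid k _ => s.src k

/-- The smallest vertex above a node. -/
def hi : Node s → ℕ
  | vert i => i
  | mid k _ => s.tgt k

/-- The order on one chain. -/
def AlongLE : Node s → Node s → Prop
  | mid k m, mid l m' => k = l ∧ m ≤ m'
  | _, _ => False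

/-- Two nodes are comparable when a vertex separates them or when they lie on the same chain. The
sizes do not enter, so the glued posets of one shape are all subposets of this one. -/
instance : PartialOrder (Node s) where
  le x y := x.hi ≤ y.lo ∨ AlongLE x y
  le_refl x := by cases x <;> simp [hi, lo, AlongLE]
  le_trans x y z := by
    rcases x with x | ⟨k, x⟩ <;> rcases y with y | ⟨l, y⟩ <;> rcases z with z | ⟨r, z⟩ <;>
      simp only [hi, lo, AlongLE] <;> have := s.src_lt <;> grind
  le_antisymm x y := by
    rcases x with x | ⟨k, x⟩ <;> rcases y with y | ⟨l, y⟩ <;>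
      simp only [hi, lo, AlongLE] <;> have := s.src_lt <;> grind

lemma vert_le_vert {i j : ℕ} : (vert i : Node s) ≤ vert j ↔ i ≤ j := by
  change _ ∨ _ ↔ _
  simp [hi, lo, AlongLE]

lemma vert_le_mid {i : ℕ} {k : Fin 6} {m : ℕ} : (vert i : Node s) ≤ mid k m ↔ i ≤ s.src k := by
  change _ ∨ _ ↔ _
  simp [hi, lo, AlongLE]

lemma mid_le_vert {i : ℕ} {k : Fin 6} {m : ℕ} : (mid k m : Node s) ≤ vert i ↔ s.tgt k ≤ i := by
  change _ ∨ _ ↔ _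
  simp [hi, lo, AlongLE]

lemma mid_le_mid {k l : Fin 6} {m m' : ℕ} :
    (mid k m : Node s) ≤ mid l m' ↔ s.tgt k ≤ s.src l ∨ k = l ∧ m ≤ m' := Iff.rfl

lemma lt_iff {x y : Node s} : x < y ↔ x ≤ y ∧ x ≠ y := lt_iff_le_and_ne

end Node

open Node

/-- Sizes of the chains along the edges, such that no chain along a redundant edge is empty. -/
def Admissible (n : Fin 6 → ℕ) : Prop := ∀ k, 2 ≤ k → 1 ≤ n k

/-- The nodes of the poset in which the chain along the edge `k` has `n k` inner elements. -/
def glued (s : Shape) (n : Fin 6 → ℕ) : Set (Node s) :=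
  {x | match x with
    | vert i => i < 4
    | mid k m => m < n k}

section Glued

variable {s : Shape} {n : Fin 6 → ℕ}

lemma vert_mem_glued {i : ℕ} : (vert i : Node s) ∈ glued s n ↔ i < 4 := Iff.rfl

lemma mid_mem_glued {k : Fin 6} {m : ℕ} : (mid k m : Node s) ∈ glued s n ↔ m < n k := Iff.rfl

/-- The `m`-th node on the chain along the edge `k`, its ends included. -/
def pathNode (s : Shape) (n : Fin 6 → ℕ) (k : Fin 6) (m : ℕ) : Node s :=
  if m = 0 then vert (s.src k) else if m ≤ n k then mid k (m - 1) else vert (s.tgt k)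

lemma pathNode_mem (k : Fin 6) (m : ℕ) : pathNode s n k m ∈ glued s n := by
  have h₁ := s.src_lt k
  have h₂ := s.tgt_le k
  unfold pathNode
  split_ifs
  · rw [vert_mem_glued]; omega
  · rw [mid_mem_glued]; omega
  · rw [vert_mem_glued]; omega

lemma pathNode_succ_of_lt {k : Fin 6} {m : ℕ} (h : m < n k) : pathNode s n k (m + 1) = mid k m := by
  simp [pathNode, Nat.succ_le_iff.2 h]

lemma pathNode_of_gt {k : Fin 6} {m : ℕ} (h : n k < m) : pathNode s n k m = vert (s.tgt k) := by
  simp [pathNode, h.not_ge, Nat.ne_of_gt (Nat.zero_lt_of_lt h)]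

lemma vert_src_le_pathNode (k : Fin 6) (m : ℕ) : vert (s.src k) ≤ pathNode s n k m := by
  have := s.src_lt k
  unfold pathNode
  split
  · exact le_rfl
  · split
    · exact vert_le_mid.2 le_rfl
    · exact vert_le_vert.2 this.le

lemma pathNode_le_vert_tgt (k : Fin 6) (m : ℕ) : pathNode s n k m ≤ vert (s.tgt k) := by
  have := s.src_lt k
  unfold pathNode
  split
  · exact vert_le_vert.2 this.le
  · split
    · exact mid_le_vert.2 le_rfl
    · exact le_rfl

lemma pathNode_lt_succ {k : Fin 6} {m : ℕ} (h : m ≤ n k) :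
    pathNode s n k m < pathNode s n k (m + 1) := by
  have h₁ := s.src_lt k
  rw [Node.lt_iff]
  unfold pathNode
  split_ifs <;> simp only [vert_le_vert, vert_le_mid, mid_le_vert, mid_le_mid, ne_eq, vert.injEq,
    mid.injEq, reduceCtorEq] <;> grind

/-- Edges with an empty chain join consecutive vertices and have no parallel. -/
lemma Admissible.eq_of_nested (hn : Admissible n) {k l : Fin 6} (hk : n k = 0)
    (h₁ : s.src k ≤ s.src l) (h₂ : s.tgt l ≤ s.tgt k) : l = k := by
  have hk2 : k < 2 := by
    by_contra h
    have := hn k (by omega)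
    omega
  have hs : s.tgt k = s.src k + 1 := by
    rcases (show k = 0 ∨ k = 1 by omega) with rfl | rfl
    · exact s.short_zero
    · exact s.short_one
  have := s.src_lt l
  by_contra hne
  rcases lt_or_gt_of_ne hne with h | h
  · have := s.parallel l k h (by omega) (by omega)
    omega
  · have := s.parallel k l h (by omega) (by omega)
    omega

/-- The delicate case is an empty chain, whose only step joins two vertices. They are consecutive,
and by `Admissible.eq_of_nested` no other edge runs between them. -/
lemma not_between_pathNode (hn : Admissible n) {k : Fin 6} {m : ℕ} (h : m ≤ n k) {c : Node s}
    (hc : c ∈ glued s n) (h₁ : pathNode s n k m < c) (h₂ : c < pathNode s n k (m + 1)) : False := by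
  have hs := s.src_lt
  have hkk := fun l => hn.eq_of_nested (s := s) (k := k) (l := l)
  have hshort : n k = 0 → s.tgt k = s.src k + 1 := by
    intro hk
    have hk2 : k < 2 := by
      by_contra h
      have := hn k (by omega)
      omega
    rcases (show k = 0 ∨ k = 1 by omega) with rfl | rfl
    · exact s.short_zero
    · exact s.short_one
  rw [Node.lt_iff] at h₁ h₂
  unfold pathNode at h₁ h₂
  rcases c with i | ⟨l, i⟩
  · rw [vert_mem_glued] at hc
    split_ifs at h₁ h₂ <;> simp only [vert_le_vert, vert_le_mid, mid_le_vert, ne_eq,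
      vert.injEq, reduceCtorEq] at h₁ h₂ <;> grind
  · rw [mid_mem_glued] at hc
    split_ifs at h₁ h₂ <;> simp only [vert_le_mid, mid_le_vert, mid_le_mid, ne_eq,
      mid.injEq, reduceCtorEq] at h₁ h₂ <;> grind

/-- The `m`-th node on the chain along the edge `k`, as an element of the glued poset. -/
def pathElt (s : Shape) (n : Fin 6 → ℕ) (k : Fin 6) (m : ℕ) : glued s n :=
  ⟨pathNode s n k m, pathNode_mem k m⟩

lemma pathElt_covBy (hn : Admissible n) {k : Fin 6} {m : ℕ} (h : m ≤ n k) :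
    pathElt s n k m ⋖ pathElt s n k (m + 1) :=
  ⟨pathNode_lt_succ h, fun c h₁ h₂ => not_between_pathNode hn h c.2 h₁ h₂⟩

/-- The inner elements of the glued poset. -/
def midElt (s : Shape) {n : Fin 6 → ℕ} (k : Fin 6) (m : ℕ) (h : m < n k) : glued s n := ⟨mid k m, h⟩

/-- The vertices of the glued poset. -/
def vertElt (s : Shape) (n : Fin 6 → ℕ) (i : ℕ) (h : i < 4) : glued s n := ⟨vert i, h⟩

lemma pathElt_of_mid {k : Fin 6} {m : ℕ} (h : m < n k) :
    pathElt s n k (m + 1) = midElt s k m h :=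
  Subtype.ext (pathNode_succ_of_lt h)

/-- The covers are the pairs of neighbours on the chains along the edges. -/
lemma covBy_iff (hn : Admissible n) {a b : glued s n} :
    a ⋖ b ↔ ∃ k m, m ≤ n k ∧ a = pathElt s n k m ∧ b = pathElt s n k (m + 1) := by
  constructor
  swap
  · rintro ⟨k, m, h, rfl, rfl⟩
    exact pathElt_covBy hn h
  intro hab
  have hlt := hab.1
  obtain ⟨a, ha⟩ := a
  obtain ⟨b, hb⟩ := b
  have hle : a ≤ b := hlt.le
  rcases a with i | ⟨k, m⟩
  · rcases b with i' | ⟨l, m'⟩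
    · have hi : i < i' := lt_of_le_of_ne (vert_le_vert.1 hle) (by rintro rfl; exact hlt.ne rfl)
      rw [vert_mem_glued] at ha hb
      -- The chain along an edge from `i` to `i + 1` starts inside the interval from `vert i` to
      -- `vert i'`, so its first step must be the given cover.
      obtain ⟨k, hk, hk'⟩ := s.consecutive i (by omega)
      have h₁ : pathElt s n k 0 = ⟨vert i, ha⟩ := Subtype.ext (by simp [pathElt, pathNode, hk])
      refine ⟨k, 0, Nat.zero_le _, h₁.symm, ?_⟩
      have hc := pathElt_covBy (s := s) hn (Nat.zero_le (n k))
      rw [h₁] at hc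
      refine (hab.eq_or_eq hc.1.le ?_).elim (fun h => absurd h hc.1.ne') Eq.symm
      exact (pathNode_le_vert_tgt k (0 + 1)).trans (vert_le_vert.2 (by omega))
    · have hm : m' < n l := hb
      -- The predecessor of an inner node on its chain lies above every vertex below that node.
      have hc := pathElt_covBy (s := s) hn hm.le
      rw [pathElt_of_mid hm] at hc
      refine ⟨l, m', hm.le, ?_, (pathElt_of_mid hm).symm⟩
      refine (hab.eq_or_eq ?_ hc.1.le).elim Eq.symm (fun h => absurd h hc.1.ne)
      exact (vert_le_vert.2 (vert_le_mid.1 hle)).trans (vert_src_le_pathNode l m')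
  · have hm : m < n k := ha
    have hc := pathElt_covBy (s := s) hn (Nat.succ_le_of_lt hm)
    rw [Nat.succ_eq_add_one, pathElt_of_mid hm] at hc
    refine ⟨k, m + 1, hm, (pathElt_of_mid hm).symm, ?_⟩
    refine (hab.eq_or_eq hc.1.le ?_).elim (fun h => absurd h hc.1.ne') Eq.symm
    have hne : (mid k m : Node s) ≠ b := fun h => hlt.ne (Subtype.ext h)
    change pathNode s n k (m + 1 + 1) ≤ b
    have hp := pathNode_le_vert_tgt (s := s) (n := n) k (m + 1 + 1)
    rcases b with i | ⟨l, m'⟩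
    · exact hp.trans (vert_le_vert.2 (mid_le_vert.1 hle))
    · have hm' : m' < n l := hb
      rw [mid_le_mid] at hle
      rcases hle with hle | ⟨rfl, hle⟩
      · exact hp.trans (vert_le_mid.2 hle)
      · have : m ≠ m' := by rintro rfl; exact hne rfl
        rw [pathNode_succ_of_lt (by omega), mid_le_mid]
        exact Or.inr ⟨rfl, by omega⟩

instance : Finite (glued s n) := by
  have : glued s n ⊆ (vert '' Set.Iio 4) ∪ ⋃ k, mid k '' Set.Iio (n k) := by
    rintro (i | ⟨k, m⟩) h
    · exact Or.inl ⟨i, h, rfl⟩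
    · exact Or.inr (Set.mem_iUnion.2 ⟨k, m, h, rfl⟩)
  exact Set.Finite.subset (((Set.finite_Iio 4).image _).union
    (Set.finite_iUnion fun k => (Set.finite_Iio (n k)).image _)) this

/-- Consecutive pairs on the chains along the edges are determined by the edge and the position. -/
lemma pathElt_pair_injective (hn : Admissible n) {k l : Fin 6} {m m' : ℕ} (hm : m ≤ n k)
    (hm' : m' ≤ n l) (h : pathElt s n k m = pathElt s n l m')
    (h' : pathElt s n k (m + 1) = pathElt s n l (m' + 1)) : k = l ∧ m = m' := by
  have h := congrArg Subtype.val h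
  have h' := congrArg Subtype.val h'
  have := hn.eq_of_nested (s := s) (k := k) (l := l)
  simp only [pathElt, pathNode] at h h'
  split_ifs at h h' <;> simp only [vert.injEq, mid.injEq] at h h' <;> grind

/-- An inner node occurs at one position of one chain only, so by `covBy_iff` its neighbours there
are its only covers. -/
lemma doublyIrr_mid (hn : Admissible n) {k : Fin 6} {m : ℕ} (h : m < n k) :
    DoublyIrr (midElt s k m h) := by
  have key : ∀ l m', m' ≤ n l + 1 → midElt s k m h = pathElt s n l m' → l = k ∧ m' = m + 1 := by
    intro l m' hm' he
    have he := congrArg Subtype.val he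
    simp only [midElt, pathElt, pathNode] at he
    split_ifs at he
    simp only [mid.injEq] at he
    refine ⟨he.1.symm, ?_⟩
    omega
  constructor
  · intro y z hy hz
    obtain ⟨l, m₁, h₁, rfl, h₂⟩ := (covBy_iff hn).1 hy
    obtain ⟨l', m₂, h₃, rfl, h₄⟩ := (covBy_iff hn).1 hz
    obtain ⟨rfl, e₁⟩ := key _ _ (by omega) h₂
    obtain ⟨rfl, e₂⟩ := key _ _ (by omega) h₄
    rw [Nat.succ_injective (e₁.trans e₂.symm)]
  · intro y z hy hz
    obtain ⟨l, m₁, h₁, h₂, rfl⟩ := (covBy_iff hn).1 hy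
    obtain ⟨l', m₂, h₃, h₄, rfl⟩ := (covBy_iff hn).1 hz
    obtain ⟨rfl, e₁⟩ := key _ _ (by omega) h₂
    obtain ⟨rfl, e₂⟩ := key _ _ (by omega) h₄
    rw [e₁.trans e₂.symm]

lemma pathElt_one_ne (hn : Admissible n) {k l : Fin 6} (hkl : k ≠ l) (h : s.src k = s.src l) :
    pathElt s n k 1 ≠ pathElt s n l 1 := fun he =>
  hkl (pathElt_pair_injective hn (Nat.zero_le _) (Nat.zero_le _)
    (Subtype.ext (congrArg vert h)) he).1

lemma pathElt_last_ne (hn : Admissible n) {k l : Fin 6} (hkl : k ≠ l) (h : s.tgt k = s.tgt l) :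
    pathElt s n k (n k) ≠ pathElt s n l (n l) := fun he =>
  hkl (pathElt_pair_injective hn le_rfl le_rfl he (Subtype.ext (by
    simp only [pathElt, pathNode_of_gt (Nat.lt_succ_self _), h]))).1

lemma pathElt_zero {i : ℕ} (hi : i < 4) {k : Fin 6} (h : s.src k = i) :
    pathElt s n k 0 = vertElt s n i hi := Subtype.ext (congrArg vert h)

lemma pathElt_end {i : ℕ} (hi : i < 4) {k : Fin 6} (h : s.tgt k = i) :
    pathElt s n k (n k + 1) = vertElt s n i hi :=
  Subtype.ext ((pathNode_of_gt (Nat.lt_succ_self _)).trans (congrArg vert h))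

lemma covers_of_src (hn : Admissible n) {i : ℕ} (hi : i < 4) {k l : Fin 6} (hkl : k ≠ l)
    (hk : s.src k = i) (hl : s.src l = i) :
    ∃ u v, u ≠ v ∧ vertElt s n i hi ⋖ u ∧ vertElt s n i hi ⋖ v :=
  ⟨_, _, pathElt_one_ne hn hkl (hk.trans hl.symm),
    pathElt_zero hi hk ▸ pathElt_covBy hn (Nat.zero_le _),
    pathElt_zero hi hl ▸ pathElt_covBy hn (Nat.zero_le _)⟩

lemma covers_of_tgt (hn : Admissible n) {i : ℕ} (hi : i < 4) {k l : Fin 6} (hkl : k ≠ l)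
    (hk : s.tgt k = i) (hl : s.tgt l = i) :
    ∃ u v, u ≠ v ∧ u ⋖ vertElt s n i hi ∧ v ⋖ vertElt s n i hi :=
  ⟨_, _, pathElt_last_ne hn hkl (hk.trans hl.symm),
    pathElt_end hi hk ▸ pathElt_covBy hn le_rfl, pathElt_end hi hl ▸ pathElt_covBy hn le_rfl⟩

lemma not_doublyIrr_vert (hn : Admissible n) {i : ℕ} (hi : i < 4) :
    ¬ DoublyIrr (vertElt s n i hi) := by
  obtain ⟨k, l, hkl, ⟨hk, hl⟩ | ⟨hk, hl⟩⟩ := s.branching i hi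
  · obtain ⟨u, v, huv, hu, hv⟩ := covers_of_src hn hi hkl hk hl
    exact fun h => huv (h.2 u v hu hv)
  · obtain ⟨u, v, huv, hu, hv⟩ := covers_of_tgt hn hi hkl hk hl
    exact fun h => huv (h.1 u v hu hv)

lemma not_doublyIrr_iff (hn : Admissible n) {x : glued s n} :
    ¬ DoublyIrr x ↔ ∃ i hi, x = vertElt s n i hi := by
  constructor
  · intro h
    obtain ⟨i | ⟨k, m⟩, hx⟩ := x
    · exact ⟨i, hx, rfl⟩
    · exact absurd (doublyIrr_mid hn hx) h
  · rintro ⟨i, hi, rfl⟩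
    exact not_doublyIrr_vert hn hi

lemma isBot_vertElt : IsBot (vertElt s n 0 (by omega)) := by
  rintro ⟨i | ⟨k, m⟩, hx⟩
  · exact vert_le_vert.2 (Nat.zero_le _)
  · exact vert_le_mid.2 (Nat.zero_le _)

lemma isTop_vertElt : IsTop (vertElt s n 3 (by omega)) := by
  rintro ⟨i | ⟨k, m⟩, hx⟩
  · exact vert_le_vert.2 (Nat.le_of_lt_succ hx)
  · exact mid_le_vert.2 (s.tgt_le k)

lemma branchingBot_glued (hn : Admissible n) : BranchingBot (glued s n) := by
  refine ⟨_, isBot_vertElt, ?_⟩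
  obtain ⟨k, l, hkl, ⟨hk, hl⟩ | ⟨hk, hl⟩⟩ := s.branching 0 (by omega)
  · exact covers_of_src hn _ hkl hk hl
  · have := s.src_lt k
    omega

lemma branchingBot_dual_glued (hn : Admissible n) : BranchingBot (glued s n)ᵒᵈ := by
  refine ⟨OrderDual.toDual (vertElt s n 3 (by omega)), fun x => isTop_vertElt (OrderDual.ofDual x),
    ?_⟩
  obtain ⟨k, l, hkl, ⟨hk, hl⟩ | ⟨hk, hl⟩⟩ := s.branching 3 (by omega)
  · have := s.src_lt k
    have := s.tgt_le k
    omega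
  · obtain ⟨u, v, huv, hu, hv⟩ := covers_of_tgt (s := s) hn (by omega) hkl hk hl
    exact ⟨OrderDual.toDual u, OrderDual.toDual v, huv, hu.toDual, hv.toDual⟩

/-- The elements of the glued poset. -/
def gluedEquiv (s : Shape) (n : Fin 6 → ℕ) : glued s n ≃ Fin 4 ⊕ Σ k, Fin (n k) where
  toFun x := match x with
    | ⟨vert i, h⟩ => Sum.inl ⟨i, h⟩
    | ⟨mid k m, h⟩ => Sum.inr ⟨k, m, h⟩
  invFun x := match x with
    | Sum.inl i => ⟨vert i, i.2⟩
    | Sum.inr ⟨k, m⟩ => ⟨mid k m, m.2⟩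
  left_inv := by rintro ⟨_ | _, _⟩ <;> rfl
  right_inv := by rintro (_ | _) <;> rfl

lemma card_glued : Nat.card (glued s n) = 4 + ∑ k, n k := by
  rw [Nat.card_congr (gluedEquiv s n)]
  simp

/-- A chain with `n k` inner elements contributes `n k + 1` covers, and no cover is counted twice.
-/
lemma ncard_covBy_glued (hn : Admissible n) :
    {q : glued s n × glued s n | q.1 ⋖ q.2}.ncard = 6 + ∑ k, n k := by
  have : Function.Bijective (fun q : Σ k, Fin (n k + 1) =>
      (⟨(pathElt s n q.1 q.2, pathElt s n q.1 (q.2 + 1)),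
        pathElt_covBy hn (Nat.le_of_lt_succ q.2.2)⟩ :
        {q : glued s n × glued s n | q.1 ⋖ q.2})) := by
    constructor
    · rintro ⟨k, m⟩ ⟨l, m'⟩ h
      simp only [Subtype.mk.injEq, Prod.mk.injEq] at h
      obtain ⟨rfl, h⟩ := pathElt_pair_injective hn (Nat.le_of_lt_succ m.2)
        (Nat.le_of_lt_succ m'.2) h.1 h.2
      rw [Fin.ext h]
    · rintro ⟨⟨a, b⟩, hab⟩
      obtain ⟨k, m, hm, rfl, rfl⟩ := (covBy_iff hn).1 hab
      exact ⟨⟨k, m, Nat.lt_succ_of_le hm⟩, rfl⟩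
  rw [← Nat.card_coe_set_eq, ← Nat.card_eq_of_bijective _ this]
  simp [Finset.sum_add_distrib, add_comm]

lemma nullity_glued (hn : Admissible n) : nullity (glued s n) = 3 := by
  unfold nullity
  rw [ncard_edgeSet_hasse, ncard_covBy_glued hn, card_glued,
    card_connectedComponent_hasse isBot_vertElt]
  push_cast
  ring

end Glued

/-! ### Lengthening a chain -/

section Bump

open Node

variable {s : Shape} {n : Fin 6 → ℕ}

/-- Lengthen the chain along the edge `k` by one element. -/
def bump (n : Fin 6 → ℕ) (k : Fin 6) : Fin 6 → ℕ := Function.update n k (n k + 1)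

lemma bump_self (k : Fin 6) : bump n k k = n k + 1 := Function.update_self ..

lemma bump_of_ne {k l : Fin 6} (h : l ≠ k) : bump n k l = n l := Function.update_of_ne h ..

lemma le_bump (k l : Fin 6) : n l ≤ bump n k l := by
  by_cases h : l = k
  · subst h; rw [bump_self]; omega
  · rw [bump_of_ne h]

lemma Admissible.bump (hn : Admissible n) (k : Fin 6) : Admissible (bump n k) :=
  fun l hl => (hn l hl).trans (le_bump k l)

/-- Make room for a new element at the position `m` of the chain along the edge `k`. -/
def shiftNode (k : Fin 6) (m : ℕ) : Node s → Node s
  | vert i => vert i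
  | mid l p => if l = k ∧ m ≤ p then mid l (p + 1) else mid l p

lemma shiftNode_mem {k : Fin 6} (m : ℕ) {x : Node s} (hx : x ∈ glued s n) :
    shiftNode k m x ∈ glued s (bump n k) := by
  rcases x with i | ⟨l, p⟩
  · exact hx
  · rw [mid_mem_glued] at hx
    simp only [shiftNode]
    split_ifs with h
    · obtain ⟨rfl, -⟩ := h
      rw [mid_mem_glued, bump_self]
      omega
    · exact lt_of_lt_of_le hx (le_bump k l)

lemma shiftNode_le_iff {k : Fin 6} {m : ℕ} {x y : Node s} :
    shiftNode k m x ≤ shiftNode k m y ↔ x ≤ y := by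
  rcases x with i | ⟨l, p⟩ <;> rcases y with i' | ⟨l', p'⟩ <;> simp only [shiftNode]
  · split_ifs <;> simp only [vert_le_mid]
  · split_ifs <;> simp only [mid_le_vert]
  · split_ifs <;> simp only [mid_le_mid] <;> grind

/-- Make room for a new element at the position `m` of the chain along the edge `k`. -/
def shift (s : Shape) (n : Fin 6 → ℕ) (k : Fin 6) (m : ℕ) : glued s n ↪o glued s (bump n k) :=
  OrderEmbedding.ofMapLEIff (fun x => ⟨shiftNode k m x, shiftNode_mem m x.2⟩)
    (fun _ _ => shiftNode_le_iff)

lemma lt_bump {k : Fin 6} {m : ℕ} (h : m ≤ n k) : m < bump n k k := by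
  rw [bump_self]; omega

lemma range_shift {k : Fin 6} {m : ℕ} (h : m ≤ n k) :
    Set.range (shift s n k m) = {midElt s k m (lt_bump h)}ᶜ := by
  ext ⟨x, hx⟩
  simp only [Set.mem_range, Set.mem_compl_iff, Set.mem_singleton_iff, Subtype.exists]
  rw [show (⟨x, hx⟩ = midElt s k m (lt_bump h)) ↔ x = mid k m from Subtype.ext_iff]
  rcases x with i | ⟨l, p⟩
  · simp only [reduceCtorEq, not_false_eq_true, iff_true]
    exact ⟨vert i, hx, rfl⟩
  · rw [mid_mem_glued] at hx
    simp only [mid.injEq, not_and]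
    constructor
    · rintro ⟨i | ⟨l', p'⟩, hx', h'⟩ rfl rfl
      · have := congrArg Subtype.val h'
        simp [shift, shiftNode] at this
      · have := congrArg Subtype.val h'
        simp only [shift, shiftNode, OrderEmbedding.coe_ofMapLEIff] at this
        split_ifs at this <;> simp only [mid.injEq] at this <;> grind
    · intro hne
      by_cases hl : l = k
      · subst hl
        rw [bump_self] at hx
        by_cases hp : p < m
        · refine ⟨mid l p, show p < n l by omega, Subtype.ext ?_⟩
          simp [shift, shiftNode, hp]
        · have hpm : p ≠ m := fun e => hne rfl e
          refine ⟨mid l (p - 1), show p - 1 < n l by omega, Subtype.ext ?_⟩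
          have h₁ : m ≤ p - 1 := by omega
          have h₂ : p - 1 + 1 = p := by omega
          simp [shift, shiftNode, h₁, h₂]
      · rw [bump_of_ne hl] at hx
        refine ⟨mid l p, hx, Subtype.ext ?_⟩
        simp [shift, shiftNode, hl]

lemma shift_pathElt {k : Fin 6} {m : ℕ} (h : m ≤ n k) :
    shift s n k m (pathElt s n k m) = pathElt s (bump n k) k m := by
  apply Subtype.ext
  rcases m with _ | m
  · rfl
  · have h₁ : m < bump n k k := by rw [bump_self]; omega
    simp [shift, pathElt, pathNode_succ_of_lt (Nat.lt_of_succ_le h), pathNode_succ_of_lt h₁,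
      shiftNode]

lemma shift_pathElt_succ {k : Fin 6} {m : ℕ} (h : m ≤ n k) :
    shift s n k m (pathElt s n k (m + 1)) = pathElt s (bump n k) k (m + 1 + 1) := by
  apply Subtype.ext
  rcases h.lt_or_eq with h | rfl
  · have h₁ : m + 1 < bump n k k := by rw [bump_self]; omega
    simp [shift, pathElt, pathNode_succ_of_lt h, pathNode_succ_of_lt h₁, shiftNode]
  · have h₁ : bump n k k < n k + 1 + 1 := by rw [bump_self]; omega
    simp [shift, pathElt, pathNode_of_gt (Nat.lt_succ_self _), pathNode_of_gt h₁, shiftNode]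

/-- The new node is doubly irreducible with the shifted neighbours as its covers. Any other node
between these would come from the shorter poset, where they form a cover. -/
lemma insertedAt_mid (hn : Admissible n) {k : Fin 6} {m : ℕ} (h : m ≤ n k) :
    InsertedAt (midElt s k m (lt_bump h)) (shift s n k m (pathElt s n k m))
      (shift s n k m (pathElt s n k (m + 1))) := by
  have hd := doublyIrr_mid (s := s) (hn.bump k) (lt_bump h)
  have h₁ := pathElt_covBy (s := s) (hn.bump k) (lt_bump h).le
  have h₂ := pathElt_covBy (s := s) (hn.bump k) (Nat.succ_le_of_lt (lt_bump h))
  rw [pathElt_of_mid (lt_bump h), ← shift_pathElt h] at h₁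
  rw [Nat.succ_eq_add_one, pathElt_of_mid (lt_bump h), ← shift_pathElt_succ h] at h₂
  refine ⟨h₁.1, h₂.1, fun w hw => ?_, fun w hw => ?_, fun w hw hw' => ?_⟩
  · obtain ⟨u, hwu, hu⟩ := exists_le_covBy_of_lt hw
    exact hd.1 u _ hu h₁ ▸ hwu
  · obtain ⟨u, hu, hwu⟩ := exists_covBy_le_of_lt hw
    exact hd.2 u _ hu h₂ ▸ hwu
  · by_contra hne
    have hr : w ∈ Set.range (shift s n k m) := by
      rw [range_shift h]
      exact hne
    obtain ⟨w, rfl⟩ := hr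
    rw [OrderEmbedding.lt_iff_lt] at hw hw'
    exact absurd hw' ((pathElt_covBy hn h).2 hw)

/-- Inserting an element into a cover of a glued poset lengthens one of the chains. -/
lemma exists_glued_of_insertedAt {P Q : Type*} [PartialOrder P] [PartialOrder Q]
    (hn : Admissible n) (φ : Q ≃o glued s n) (f : Q ↪o P) {x : P} {y z : Q}
    (hf : Set.range f = {x}ᶜ) (hx : InsertedAt x (f y) (f z)) :
    ∃ k, Nonempty (P ≃o glued s (bump n k)) := by
  -- Only `x` lies between `f y` and `f z`, and `x` is not in the range of `f`.
  have hyz : y ⋖ z := by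
    refine ⟨f.lt_iff_lt.1 (hx.left.trans hx.right), fun c hc hc' => ?_⟩
    have hc0 := hx.alone (f c) (f.lt_iff_lt.2 hc) (f.lt_iff_lt.2 hc')
    have := Set.mem_range_self (f := f) c
    rw [hf] at this
    exact this hc0
  obtain ⟨k, m, hm, hy, hz⟩ := (covBy_iff hn).1 ((apply_covBy_apply_iff φ).2 hyz)
  refine ⟨k, nonempty_orderIso_of_insertedAt f
    (φ.toOrderEmbedding.trans (shift s n k m)) hf
    (x' := midElt s k m (lt_bump hm)) ?_ hx (y := y) (z := z) ?_⟩
  · rw [← range_shift hm]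
    ext w
    simp only [Set.mem_range, RelEmbedding.coe_trans, Function.comp_apply]
    exact ⟨fun ⟨q, hq⟩ => ⟨_, hq⟩, fun ⟨q, hq⟩ => ⟨φ.symm q, by simpa using hq⟩⟩
  · have := insertedAt_mid (s := s) hn hm
    rw [← hy, ← hz] at this
    exact this

/-- A poset that retracts to a glued poset is itself a glued poset. -/
lemma exists_glued_of_retractSteps {P : Type*} [PartialOrder P] [Finite P] {S T : Set P}
    (h : Relation.ReflTransGen RetractStep S T) (hn : Admissible n) (φ : T ≃o glued s n) :
    ∃ n', Admissible n' ∧ Nonempty (S ≃o glued s n') := by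
  induction h using Relation.ReflTransGen.head_induction_on with
  | refl => exact ⟨n, hn, ⟨φ⟩⟩
  | head hs _ ih =>
    obtain ⟨n', hn', ⟨φ'⟩⟩ := ih
    obtain ⟨f, x, y, z, hf, hx⟩ := hs.exists_insertedAt
    obtain ⟨k, hk⟩ := exists_glued_of_insertedAt hn' φ' f hf hx
    exact ⟨_, hn'.bump k, hk⟩

end Bump

/-! ### Reduction to the smallest admissible sizes -/

section Base

open Node

variable {s : Shape} {n : Fin 6 → ℕ}

/-- The smallest admissible sizes. -/
def minSizes : Fin 6 → ℕ := ![0, 0, 1, 1, 1, 1]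

lemma admissible_iff : Admissible n ↔ ∀ k, minSizes k ≤ n k := by
  simp only [Admissible, Fin.forall_fin_succ, minSizes]
  simp

lemma admissible_minSizes : Admissible minSizes := admissible_iff.2 fun _ => le_rfl

lemma minSizes_eq_one {k : Fin 6} (h : 0 < minSizes k) : 2 ≤ k ∧ minSizes k = 1 := by
  revert k
  decide

/-- Vertices are reducible. The single inner node of a chain is never alone between its ends: a long
edge passes the vertex `src + 1`, and each parallel edge has the inner node of the other one beside
it. -/
lemma isBasicRetract_glued_minSizes {P : Type*} [PartialOrder P] [Finite P]
    (φ : P ≃o glued s minSizes) : IsBasicRetract P := by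
  rw [isBasicRetract_iff]
  intro x' y' z' h
  replace h := h.map φ
  generalize φ x' = x at h
  generalize φ y' = y at h
  generalize φ z' = z at h
  obtain ⟨i | ⟨k, m⟩, hx⟩ := x
  · exact not_doublyIrr_vert admissible_minSizes hx h.doublyIrr
  · have hm : m < minSizes k := hx
    obtain ⟨hk, hk1⟩ := minSizes_eq_one (Nat.zero_lt_of_lt hm)
    obtain rfl : m = 0 := by omega
    have h₁ := pathElt_covBy (s := s) admissible_minSizes hm.le
    have h₂ := pathElt_covBy (s := s) admissible_minSizes (Nat.succ_le_of_lt hm)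
    rw [pathElt_of_mid hm] at h₁
    rw [Nat.succ_eq_add_one, pathElt_of_mid hm] at h₂
    have hy := h.eq_of_covBy_left h₁
    have hz := h.eq_of_covBy_right h₂
    subst hy hz
    have h4 := s.src_parallel
    have h5 := s.tgt_parallel
    have hlt := s.src_lt k
    have h3 := s.tgt_le k
    have key : ∀ w : glued s minSizes, vert (s.src k) ≤ w.1 → w.1 ≤ vert (s.tgt k) →
        w.1 ≠ vert (s.src k) → w.1 ≠ vert (s.tgt k) → w.1 = mid k 0 := by
      intro w w₁ w₂ w₃ w₄
      have hz : pathNode s minSizes k (0 + 1 + 1) = vert (s.tgt k) := pathNode_of_gt (by omega)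
      refine congrArg Subtype.val (h.alone w ?_ ?_)
      · exact Node.lt_iff.2 ⟨w₁, w₃.symm⟩
      · refine Node.lt_iff.2 ⟨?_, ?_⟩
        · change w.1 ≤ pathNode s minSizes k (0 + 1 + 1)
          rwa [hz]
        · change w.1 ≠ pathNode s minSizes k (0 + 1 + 1)
          rwa [hz]
    have hvert : s.src k + 1 < s.tgt k → False := by
      intro hs
      have := key ⟨vert (s.src k + 1), show s.src k + 1 < 4 by omega⟩
        (vert_le_vert.2 (by omega)) (vert_le_vert.2 (by omega)) (by simp) (by
          simp only [ne_eq, vert.injEq]; omega)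
      simp at this
    have hmid : ∀ l, l ≠ k → 0 < minSizes l → s.src l = s.src k → s.tgt l = s.tgt k → False := by
      intro l hl hl' hs ht
      have := key ⟨mid l 0, hl'⟩ (vert_le_mid.2 hs.ge) (mid_le_vert.2 ht.le) (by simp) (by simp)
      simp only [mid.injEq, and_true] at this
      exact hl this
    rcases (show k = 2 ∨ k = 3 ∨ k = 4 ∨ k = 5 by omega) with rfl | rfl | rfl | rfl
    · exact hvert s.long_two
    · exact hvert s.long_three
    · exact hmid 5 (by decide) (by decide) h4.symm h5.symm
    · exact hmid 4 (by decide) (by decide) h4 h5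

/-- Every glued poset retracts to the one with the smallest sizes. -/
lemma exists_retractSteps {P : Type*} [PartialOrder P] [Finite P] {S : Set P} (hn : Admissible n)
    (φ : S ≃o glued s n) : ∃ T : Set P, Relation.ReflTransGen RetractStep S T ∧
      Nonempty (T ≃o glued s minSizes) := by
  induction hN : ∑ k, n k generalizing n S with
  -- This case is impossible, since the chain along the edge `2` is not empty.
  | zero =>
    have := hn 2 le_rfl
    have := Finset.single_le_sum (f := n) (fun i _ => Nat.zero_le _) (Finset.mem_univ 2)
    omega
  | succ N ih =>
    by_cases hmin : n = minSizes
    · subst hmin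
      exact ⟨S, .refl, ⟨φ⟩⟩
    · obtain ⟨k, hk⟩ : ∃ k, minSizes k < n k := by
        by_contra! h
        exact hmin (funext fun k => (h k).antisymm (admissible_iff.1 hn k))
      -- A chain longer than its minimum can be shortened; the node removed is the one at position
      -- `0`.
      obtain ⟨n', rfl, hn'⟩ : ∃ n', n = bump n' k ∧ Admissible n' := by
        refine ⟨Function.update n k (n k - 1), ?_, admissible_iff.2 fun l => ?_⟩
        · have : n k - 1 + 1 = n k := by omega
          simp [bump, this]
        · by_cases hl : l = k
          · subst hl
            rw [Function.update_self]
            omega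
          · rw [Function.update_of_ne hl]
            exact admissible_iff.1 hn l
      have h₀ := insertedAt_mid (s := s) hn' (Nat.zero_le (n' k))
      have hr := range_shift (s := s) (Nat.zero_le (n' k))
      have h₁ := h₀.map φ.symm
      have hmem : ∀ q, φ.symm (shift s n' k 0 q) ≠
          φ.symm (midElt s k 0 (lt_bump (Nat.zero_le _))) := by
        intro q hq
        have := Set.mem_range_self (f := shift s n' k 0) q
        rw [hr] at this
        exact this (φ.symm.injective hq)
      let F : glued s n' →
          (S \ {((φ.symm (midElt s k 0 (lt_bump (Nat.zero_le _))) : S) : P)} : Set P) :=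
        fun q => ⟨(φ.symm (shift s n' k 0 q) : S), Subtype.coe_prop _,
          fun e => hmem q (Subtype.ext e)⟩
      have hF : Function.Surjective F := by
        rintro ⟨w, hw, hw'⟩
        have : φ ⟨w, hw⟩ ∈ Set.range (shift s n' k 0) := by
          rw [hr]
          intro e
          exact hw' (congrArg Subtype.val ((φ.symm_apply_apply ⟨w, hw⟩).symm.trans
            (congrArg φ.symm e)))
        obtain ⟨q, hq⟩ := this
        refine ⟨q, Subtype.ext ?_⟩
        simp only [F, hq, OrderIso.symm_apply_apply]
      have hF' : ∀ a b, F a ≤ F b ↔ a ≤ b := fun a b => by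
        change φ.symm _ ≤ φ.symm _ ↔ _
        rw [OrderIso.le_iff_le, OrderEmbedding.le_iff_le]
      obtain ⟨T, hT, hT'⟩ := ih hn' (RelIso.ofSurjective (OrderEmbedding.ofMapLEIff F hF') hF).symm
        (by
          have : ∑ l, bump n' k l = ∑ l, n' l + 1 := by
            rw [bump, Finset.sum_update_of_mem (Finset.mem_univ k),
              ← Finset.add_sum_erase _ n' (Finset.mem_univ k), Finset.sdiff_singleton_eq_erase]
            ring
          omega)
      exact ⟨T, .head h₁.retractStep hT, hT'⟩

end Base

/-! ### Glued posets as blocks -/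

section Block

open Node

variable {s : Shape} {n : Fin 6 → ℕ}

lemma BranchingBot.congr {P Q : Type*} [PartialOrder P] [PartialOrder Q] (φ : P ≃o Q)
    (h : BranchingBot P) : BranchingBot Q := by
  obtain ⟨b, hb, u, v, huv, hu, hv⟩ := h
  exact ⟨φ b, fun x => φ.apply_symm_apply x ▸ φ.le_iff_le.2 (hb _), φ u, φ v,
    fun e => huv (φ.injective e), (apply_covBy_apply_iff φ).2 hu, (apply_covBy_apply_iff φ).2 hv⟩

lemma doublyIrr_congr {P Q : Type*} [PartialOrder P] [PartialOrder Q] (φ : P ≃o Q) {x : P} :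
    DoublyIrr (φ x) ↔ DoublyIrr x := by
  simp only [DoublyIrr, φ.surjective.forall, apply_covBy_apply_iff, φ.injective.eq_iff]

/-- A lattice isomorphic to a glued poset is a block with four reducible elements, of nullity three,
and its basic block is the smallest glued poset of the same shape. -/
lemma isBlockOfType_of_glued {B L : Type*} [PartialOrder B] [Lattice L] [Finite L]
    (hn : Admissible n) (φ : L ≃o glued s n) (ψ : B ≃o glued s minSizes) :
    IsBlockOfType B 4 3 L := by
  have hred : latticeRed L = Set.range (fun i : Fin 4 => φ.symm (vertElt s n i i.2)) := by
    ext a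
    rw [mem_latticeRed_iff, ← doublyIrr_congr φ, not_doublyIrr_iff hn]
    constructor
    · rintro ⟨i, hi, h⟩
      exact ⟨⟨i, hi⟩, by rw [← φ.symm_apply_apply a, h]⟩
    · rintro ⟨i, rfl⟩
      exact ⟨i, i.2, φ.apply_symm_apply _⟩
  have hb := branchingBot_glued (s := s) hn
  have hb' := branchingBot_dual_glued (s := s) hn
  refine ⟨isBlock_iff.2 ⟨hb.congr φ.symm, hb'.congr φ.symm.dual⟩, ?_, ?_, ?_, ?_⟩
  · have hinj : Function.Injective (fun i : Fin 4 => φ.symm (vertElt s n i i.2)) := by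
      intro i j h
      have := congrArg Subtype.val (φ.symm.injective h)
      simp only [vertElt, vert.injEq] at this
      exact Fin.ext this
    rw [hred, ← Nat.card_coe_set_eq, Nat.card_range_of_injective hinj, Nat.card_fin]
  · rw [hred]
    rintro _ ⟨i, rfl⟩ _ ⟨j, rfl⟩ -
    rcases le_total i j with h | h
    · exact Or.inl (φ.symm.le_iff_le.2 (vert_le_vert.2 h))
    · exact Or.inr (φ.symm.le_iff_le.2 (vert_le_vert.2 h))
  · rw [nullity_congr φ, nullity_glued hn]
    rfl
  · obtain ⟨T, hT, ⟨χ⟩⟩ := exists_retractSteps hn (OrderIso.Set.univ.trans φ)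
    -- The retract has no pendant vertices, so the second phase of the reduction is empty.
    refine ⟨T, T, hT, isBasicRetract_glued_minSizes χ, .refl, ?_, ⟨ψ.trans χ.symm⟩⟩
    exact not_isPendant_of_branching ((branchingBot_glued admissible_minSizes).congr χ.symm)
      ((branchingBot_dual_glued admissible_minSizes).congr χ.symm.dual)

/-- Every block with the smallest glued poset as basic block is a glued poset. -/
lemma exists_glued_of_isBlockOfType {B L : Type*} [PartialOrder B] [Lattice L] [Finite L]
    {r k : ℕ} (h : IsBlockOfType B r k L) (ψ : B ≃o glued s minSizes) :
    ∃ n, Admissible n ∧ Nonempty (L ≃o glued s n) := by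
  obtain ⟨hb, -, -, -, S, T, hS, -, hT, -, ⟨χ⟩⟩ := h
  obtain ⟨h₀, h₁⟩ := isBlock_iff.1 hb
  obtain ⟨h₂, h₃⟩ := branching_of_retract hS (h₀.congr OrderIso.Set.univ.symm)
    (h₁.congr OrderIso.Set.univ.symm.dual)
  obtain rfl := eq_of_pendantSteps hT (not_isPendant_of_branching h₂ h₃)
  obtain ⟨n, hn, ⟨φ⟩⟩ := exists_glued_of_retractSteps hS admissible_minSizes (χ.symm.trans ψ)
  exact ⟨n, hn, ⟨OrderIso.Set.univ.symm.trans φ⟩⟩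

lemma hi_lt_four {x : Node s} (hx : x ∈ glued s n) : x.hi < 4 := by
  rcases x with i | ⟨k, m⟩
  · exact hx
  · exact Nat.lt_succ_of_le (s.tgt_le k)

lemma lo_lt_four {x : Node s} (hx : x ∈ glued s n) : x.lo < 4 := by
  rcases x with i | ⟨k, m⟩
  · exact hx
  · exact (s.src_lt k).trans_le ((s.tgt_le k).trans (by omega))

lemma le_vert_iff {x : Node s} {i : ℕ} : x ≤ vert i ↔ x.hi ≤ i := by
  cases x
  · exact vert_le_vert
  · exact mid_le_vert

lemma vert_le_iff {x : Node s} {i : ℕ} : vert i ≤ x ↔ i ≤ x.lo := by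
  cases x
  · exact vert_le_vert
  · exact vert_le_mid

/-- An upper bound `z` on the chain of `x` that is not above the vertex `x.hi` would make `x` and
`y` comparable. Hence joins of incomparable nodes are vertices, and dually for meets; this makes
every glued poset a lattice. -/
lemma vert_max_hi_le {x y z : Node s} (hxy : ¬ x ≤ y) (hyx : ¬ y ≤ x) (hx : x ≤ z) (hy : y ≤ z) :
    vert (max x.hi y.hi) ≤ z := by
  have := s.src_lt
  rw [vert_le_iff]
  rcases x with x | ⟨k, x⟩ <;> rcases y with y | ⟨l, y⟩ <;> rcases z with z | ⟨r, z⟩ <;>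
    simp only [vert_le_vert, vert_le_mid, mid_le_vert, mid_le_mid, hi, lo] at * <;> grind

lemma le_vert_min_lo {x y z : Node s} (hxy : ¬ x ≤ y) (hyx : ¬ y ≤ x) (hx : z ≤ x) (hy : z ≤ y) :
    z ≤ vert (min x.lo y.lo) := by
  have := s.src_lt
  rw [le_vert_iff]
  rcases x with x | ⟨k, x⟩ <;> rcases y with y | ⟨l, y⟩ <;> rcases z with z | ⟨r, z⟩ <;>
    simp only [vert_le_vert, vert_le_mid, mid_le_vert, mid_le_mid, hi, lo] at * <;> grind

open Classical in
noncomputable instance : Lattice (glued s n) where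
  sup x y := if x ≤ y then y else if y ≤ x then x else
    vertElt s n (max x.1.hi y.1.hi) (max_lt (hi_lt_four x.2) (hi_lt_four y.2))
  inf x y := if x ≤ y then x else if y ≤ x then y else
    vertElt s n (min x.1.lo y.1.lo) (min_lt_of_left_lt (lo_lt_four x.2))
  le_sup_left x y := by
    split_ifs with h₁ h₂
    · exact h₁
    · exact le_rfl
    · exact le_vert_iff.2 (le_max_left _ _)
  le_sup_right x y := by
    split_ifs with h₁ h₂
    · exact le_rfl
    · exact h₂
    · exact le_vert_iff.2 (le_max_right _ _)
  sup_le x y z hx hy := by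
    split_ifs with h₁ h₂
    · exact hy
    · exact hx
    · exact vert_max_hi_le h₁ h₂ hx hy
  inf_le_left x y := by
    split_ifs with h₁ h₂
    · exact le_rfl
    · exact h₂
    · exact vert_le_iff.2 (min_le_left _ _)
  inf_le_right x y := by
    split_ifs with h₁ h₂
    · exact h₁
    · exact le_rfl
    · exact vert_le_iff.2 (min_le_right _ _)
  le_inf z x y hx hy := by
    split_ifs with h₁ h₂
    · exact hx
    · exact hy
    · exact le_vert_min_lo h₁ h₂ hx hy

end Block

/-! ### The sizes are determined by the isomorphism type -/

section Invariants

open Node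

variable {s : Shape} {n n' : Fin 6 → ℕ}

/-- The vertices are the reducible elements, so `χ` maps them to vertices, and a strictly increasing
self-map of a four-element chain is the identity. -/
lemma orderIso_vertElt (hn : Admissible n) (hn' : Admissible n') (χ : glued s n ≃o glued s n')
    {i : ℕ} (hi : i < 4) : χ (vertElt s n i hi) = vertElt s n' i hi := by
  have key : ∀ i (hi : i < 4), ∃ i', ∃ hi' : i' < 4, χ (vertElt s n i hi) = vertElt s n' i' hi' :=
    fun i hi => (not_doublyIrr_iff hn').1
      (mt (doublyIrr_congr χ).1 (not_doublyIrr_vert hn hi))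
  choose f hf hfe using key
  have mono : ∀ i i' (hi : i < 4) (hi' : i' < 4), i < i' → f i hi < f i' hi' := by
    intro i i' hi hi' h
    have h₁ : vertElt s n i hi < vertElt s n i' hi' := by
      refine Node.lt_iff.2 ⟨vert_le_vert.2 h.le, ?_⟩
      simp only [vertElt, ne_eq, vert.injEq]
      omega
    rw [← χ.lt_iff_lt, hfe, hfe] at h₁
    have h₂ := Node.lt_iff.1 h₁
    simp only [vertElt, vert_le_vert, ne_eq, vert.injEq] at h₂
    omega
  have hfi : f i hi = i := by
    have h₀ := mono 0 1 (by omega) (by omega) (by omega)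
    have h₁ := mono 1 2 (by omega) (by omega) (by omega)
    have h₂ := mono 2 3 (by omega) (by omega) (by omega)
    have h₃ := hf 3 (by omega)
    interval_cases i <;> omega
  rw [hfe]
  exact Subtype.ext (congrArg vert hfi)

lemma orderIso_lo (hn : Admissible n) (hn' : Admissible n') (χ : glued s n ≃o glued s n')
    (x : glued s n) : (χ x).1.lo = x.1.lo := by
  have key : ∀ i < 4, i ≤ (χ x).1.lo ↔ i ≤ x.1.lo := fun i hi => by
    have h₁ : vertElt s n' i hi ≤ χ x ↔ vertElt s n i hi ≤ x := by
      rw [← orderIso_vertElt hn hn' χ hi, χ.le_iff_le]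
    exact vert_le_iff.symm.trans (h₁.trans vert_le_iff)
  have h₁ := lo_lt_four x.2
  have h₂ := lo_lt_four (χ x).2
  exact le_antisymm ((key _ h₂).1 le_rfl) ((key _ h₁).2 le_rfl)

lemma orderIso_hi (hn : Admissible n) (hn' : Admissible n') (χ : glued s n ≃o glued s n')
    (x : glued s n) : (χ x).1.hi = x.1.hi := by
  have key : ∀ i < 4, (χ x).1.hi ≤ i ↔ x.1.hi ≤ i := fun i hi => by
    have h₁ : χ x ≤ vertElt s n' i hi ↔ x ≤ vertElt s n i hi := by
      rw [← orderIso_vertElt hn hn' χ hi, χ.le_iff_le]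
    exact le_vert_iff.symm.trans (h₁.trans le_vert_iff)
  have h₁ := hi_lt_four x.2
  have h₂ := hi_lt_four (χ x).2
  exact le_antisymm ((key _ h₁).2 le_rfl) ((key _ h₂).1 le_rfl)

/-- The elements comparable with `x` that lie between the same vertices. -/
def chainOf (x : glued s n) : Set (glued s n) :=
  {y | y.1.lo = x.1.lo ∧ y.1.hi = x.1.hi ∧ (x ≤ y ∨ y ≤ x)}

/-- Equal `lo` and `hi` leave only the edge `k` and its parallel; comparability rules out the
parallel one. Vertices are excluded because their `lo` and `hi` agree. -/
lemma card_chainOf {k : Fin 6} {m : ℕ} (h : m < n k) :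
    Nat.card (chainOf (midElt s k m h)) = n k := by
  have hs := s.src_lt k
  have hmem : ∀ p (hp : p < n k), midElt s k p hp ∈ chainOf (midElt s k m h) := fun p hp =>
    ⟨rfl, rfl, (le_total m p).imp (fun h => mid_le_mid.2 (Or.inr ⟨rfl, h⟩))
      (fun h => mid_le_mid.2 (Or.inr ⟨rfl, h⟩))⟩
  have : Function.Bijective (fun p : Fin (n k) =>
      (⟨midElt s k p p.2, hmem p p.2⟩ : chainOf (midElt s k m h))) := by
    constructor
    · intro p q hpq
      have h₁ := congrArg (fun x => x.1.1) hpq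
      simp only [midElt, mid.injEq, true_and] at h₁
      exact Fin.ext h₁
    · rintro ⟨⟨i | ⟨l, p⟩, hx⟩, h₁, h₂, h₃⟩
      · change i = s.src k at h₁
        change i = s.tgt k at h₂
        omega
      · change s.src l = s.src k at h₁
        change s.tgt l = s.tgt k at h₂
        obtain rfl : l = k := by
          rcases h₃ with h₃ | h₃
          · rcases mid_le_mid.1 h₃ with h₃ | h₃
            · omega
            · exact h₃.1.symm
          · rcases mid_le_mid.1 h₃ with h₃ | h₃
            · omega
            · exact h₃.1
        exact ⟨⟨p, hx⟩, rfl⟩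
  rw [← Nat.card_eq_of_bijective _ this, Nat.card_fin]

/-- `chainOf` is defined from the order, `lo` and `hi`, all of which `χ` preserves, so the chain
through a node keeps its length and its end vertices. -/
lemma exists_parallel_eq (hn : Admissible n) (hn' : Admissible n') (χ : glued s n ≃o glued s n')
    {k : Fin 6} (hk : 0 < n k) :
    ∃ l, s.src l = s.src k ∧ s.tgt l = s.tgt k ∧ n k = n' l := by
  have h₁ := orderIso_lo hn hn' χ (midElt s k 0 hk)
  have h₂ := orderIso_hi hn hn' χ (midElt s k 0 hk)
  have h₃ : Nat.card (chainOf (midElt s k 0 hk)) = Nat.card (chainOf (χ (midElt s k 0 hk))) := by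
    refine Nat.card_congr (χ.toEquiv.subtypeEquiv fun y => ?_)
    change _ ↔ (χ y).1.lo = _ ∧ (χ y).1.hi = _ ∧ (χ _ ≤ χ y ∨ χ y ≤ χ _)
    rw [h₁, h₂, orderIso_lo hn hn', orderIso_hi hn hn', χ.le_iff_le, χ.le_iff_le]
    rfl
  rw [card_chainOf] at h₃
  generalize χ (midElt s k 0 hk) = y at h₁ h₂ h₃
  obtain ⟨i | ⟨l, m⟩, hy⟩ := y
  · change i = s.src k at h₁
    change i = s.tgt k at h₂
    have := s.src_lt k
    omega
  · exact ⟨l, h₁, h₂, h₃.trans (card_chainOf (show m < n' l from hy))⟩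

/-- Edges without a parallel keep their sizes. For the parallel pair, `n 4` is one of `n' 4`, `n'
5`; equal cardinalities give equal sums, and the sorting does the rest. -/
lemma sizes_eq (hn : Admissible n) (hn' : Admissible n') (χ : glued s n ≃o glued s n')
    (h : n 4 ≤ n 5) (h' : n' 4 ≤ n' 5) : n = n' := by
  have simple : ∀ k l : Fin 6, k < 4 → s.src l = s.src k → s.tgt l = s.tgt k → l = k := by
    intro k l hk h₁ h₂
    by_contra hne
    rcases lt_or_gt_of_ne hne with hl | hl
    · have := s.parallel l k hl h₁ h₂
      omega
    · have := s.parallel k l hl h₁.symm h₂.symm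
      omega
  have eq : ∀ k : Fin 6, k < 4 → n k = n' k := by
    intro k hk
    rcases Nat.eq_zero_or_pos (n k) with h₀ | h₀
    · rcases Nat.eq_zero_or_pos (n' k) with h₁ | h₁
      · omega
      · obtain ⟨l, h₂, h₃, h₄⟩ := exists_parallel_eq hn' hn χ.symm h₁
        obtain rfl := simple k l hk h₂ h₃
        exact h₄.symm
    · obtain ⟨l, h₂, h₃, h₄⟩ := exists_parallel_eq hn hn' χ h₀
      obtain rfl := simple k l hk h₂ h₃
      exact h₄
  have e₀ := eq 0 (by decide)
  have e₁ := eq 1 (by decide)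
  have e₂ := eq 2 (by decide)
  have e₃ := eq 3 (by decide)
  have hc := Nat.card_congr χ.toEquiv
  rw [card_glued, card_glued, Fin.sum_univ_six, Fin.sum_univ_six] at hc
  have e₄ : n 4 = n' 4 ∨ n 4 = n' 5 := by
    obtain ⟨l, h₂, h₃, h₄⟩ := exists_parallel_eq hn hn' χ (hn 4 (by decide))
    have : l = 4 ∨ l = 5 := by
      by_contra hl
      have := simple l 4 (by omega) h₂.symm h₃.symm
      omega
    rcases this with rfl | rfl
    · exact Or.inl h₄
    · exact Or.inr h₄
  funext k
  fin_cases k <;> simp only [Fin.zero_eta, Fin.mk_one, Fin.reduceFinMk] <;> omega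

/-- Exchange the parallel edges. -/
def swapNode : Node s → Node s
  | vert i => vert i
  | mid k m => mid (Equiv.swap 4 5 k) m

lemma swapNode_swapNode (x : Node s) : swapNode (swapNode x) = x := by
  cases x <;> simp [swapNode]

lemma Shape.src_swap (s : Shape) (k : Fin 6) : s.src (Equiv.swap 4 5 k) = s.src k := by
  rw [Equiv.swap_apply_def]
  split_ifs with h₁ h₂
  · rw [h₁, s.src_parallel]
  · rw [h₂, s.src_parallel]
  · rfl

lemma Shape.tgt_swap (s : Shape) (k : Fin 6) : s.tgt (Equiv.swap 4 5 k) = s.tgt k := by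
  rw [Equiv.swap_apply_def]
  split_ifs with h₁ h₂
  · rw [h₁, s.tgt_parallel]
  · rw [h₂, s.tgt_parallel]
  · rfl

lemma swapNode_mem {x : Node s} : swapNode x ∈ glued s (n ∘ Equiv.swap 4 5) ↔ x ∈ glued s n := by
  rcases x with i | ⟨k, m⟩
  · rfl
  · simp [swapNode, mid_mem_glued]

/-- Exchanging the parallel edges does not change the isomorphism type. -/
def swapIso (s : Shape) (n : Fin 6 → ℕ) : glued s n ≃o glued s (n ∘ Equiv.swap 4 5) where
  toFun x := ⟨swapNode x, swapNode_mem.2 x.2⟩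
  invFun x := ⟨swapNode x, by
    have := x.2
    rwa [← swapNode_swapNode x.1, swapNode_mem] at this⟩
  left_inv x := Subtype.ext (swapNode_swapNode _)
  right_inv x := Subtype.ext (swapNode_swapNode _)
  map_rel_iff' := by
    rintro ⟨i | ⟨k, m⟩, hx⟩ ⟨i' | ⟨l, m'⟩, hy⟩
    · exact Iff.rfl
    · change vert i ≤ mid _ _ ↔ vert i ≤ mid _ _
      rw [vert_le_mid, vert_le_mid, s.src_swap]
    · change mid _ _ ≤ vert i' ↔ mid _ _ ≤ vert i'
      rw [mid_le_vert, mid_le_vert, s.tgt_swap]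
    · change mid _ _ ≤ mid _ _ ↔ mid _ _ ≤ mid _ _
      rw [mid_le_mid, mid_le_mid, s.src_swap, s.tgt_swap, (Equiv.swap 4 5).injective.eq_iff]

/-- Sizes with a given total, up to exchanging the parallel edges. -/
def sortedSizes (N : ℕ) : Set (Fin 6 → ℕ) :=
  {n | Admissible n ∧ n 4 ≤ n 5 ∧ 4 + ∑ k, n k = N}

lemma exists_sorted (hn : Admissible n) :
    ∃ n', Admissible n' ∧ n' 4 ≤ n' 5 ∧ Nonempty (glued s n ≃o glued s n') := by
  rcases le_total (n 4) (n 5) with h | h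
  · exact ⟨n, hn, h, ⟨OrderIso.refl _⟩⟩
  · refine ⟨_, fun k hk => hn _ ?_, ?_, ⟨swapIso s n⟩⟩
    · revert k
      decide
    · simpa using h

end Invariants

/-! ### The number of blocks -/

section Count

/-- Transport of a lattice structure along an equivalence. -/
@[reducible]
def latticeOfEquiv {α β : Type*} [Lattice β] (e : α ≃ β) : Lattice α where
  toPartialOrder := PartialOrder.lift e e.injective
  sup a b := e.symm (e a ⊔ e b)
  inf a b := e.symm (e a ⊓ e b)
  le_sup_left a b := by
    change e a ≤ e (e.symm _)
    rw [e.apply_symm_apply]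
    exact le_sup_left
  le_sup_right a b := by
    change e b ≤ e (e.symm _)
    rw [e.apply_symm_apply]
    exact le_sup_right
  sup_le a b c h₁ h₂ := by
    change e (e.symm _) ≤ e c
    rw [e.apply_symm_apply]
    exact sup_le h₁ h₂
  inf_le_left a b := by
    change e (e.symm _) ≤ e a
    rw [e.apply_symm_apply]
    exact inf_le_left
  inf_le_right a b := by
    change e (e.symm _) ≤ e b
    rw [e.apply_symm_apply]
    exact inf_le_right
  le_inf a b c h₁ h₂ := by
    change e a ≤ e (e.symm _)
    rw [e.apply_symm_apply]
    exact le_inf h₁ h₂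

/-- The equivalence along which a lattice structure is transported is an isomorphism. -/
def latticeOfEquivIso {α β : Type*} [Lattice β] (e : α ≃ β) :
    @OrderIso α β (latticeOfEquiv e).toLE _ :=
  letI := latticeOfEquiv e
  { e with map_rel_iff' := Iff.rfl }

variable {s : Shape} {N : ℕ}

lemma nonempty_equiv_glued {n : Fin 6 → ℕ} (h : n ∈ sortedSizes N) :
    Nonempty (Fin N ≃ glued s n) :=
  ⟨(Finite.equivFinOfCardEq (card_glued.trans h.2.2)).symm⟩

/-- A labelling of a glued poset. -/
noncomputable def labelGlued (s : Shape) {n : Fin 6 → ℕ} (h : n ∈ sortedSizes N) :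
    Fin N ≃ glued s n := (nonempty_equiv_glued h).some

/-- Sorted sizes are a complete invariant: `sizes_eq` gives injectivity,
`exists_glued_of_isBlockOfType` with `exists_sorted` gives surjectivity. The right-hand side does
not mention the shape, whence the same count for all seven basic blocks. -/
lemma numBlocks_eq_card_sortedSizes {B : Type*} [PartialOrder B] (ψ : B ≃o glued s minSizes) :
    numBlocks B N 4 3 = Nat.card (sortedSizes N) := by
  let F : sortedSizes N → Quotient (labelledBlockSetoid B N 4 3) := fun n =>
    Quotient.mk _ ⟨latticeOfEquiv (labelGlued s n.2),
      @isBlockOfType_of_glued s n.1 B (Fin N) _ (latticeOfEquiv (labelGlued s n.2)) _ n.2.1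
        (latticeOfEquivIso _) ψ⟩
  refine (Nat.card_eq_of_bijective F ⟨?_, ?_⟩).symm
  · intro n n' h
    obtain ⟨χ⟩ := Quotient.exact h
    have χ' := (@OrderIso.trans _ _ _ _ (_) _ (@OrderIso.trans _ _ _ _ (_) (_)
      (@OrderIso.symm _ _ (_) _ (latticeOfEquivIso (labelGlued s n.2))) χ)
      (latticeOfEquivIso (labelGlued s n'.2)))
    exact Subtype.ext (sizes_eq n.2.1 n'.2.1 χ' n.2.2.1 n'.2.2.1)
  · intro q
    induction q using Quotient.inductionOn with | _ L =>
    obtain ⟨n, hn, ⟨φ⟩⟩ := @exists_glued_of_isBlockOfType s B (Fin N) _ L.1 _ 4 3 L.2 ψ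
    obtain ⟨n', hn', h', ⟨χ⟩⟩ := exists_sorted (s := s) hn
    have φ' := @OrderIso.trans _ _ _ (_) _ _ φ χ
    have hcard : 4 + ∑ k, n' k = N := by
      have := Nat.card_congr (@RelIso.toEquiv _ _ _ _ φ')
      rw [Nat.card_fin, card_glued] at this
      exact this.symm
    have hmem : n' ∈ sortedSizes N := ⟨hn', h', hcard⟩
    exact ⟨⟨n', hmem⟩, Quotient.sound ⟨@OrderIso.trans _ _ _ (_) _ (_)
      (latticeOfEquivIso (labelGlued s hmem)) (@OrderIso.symm _ _ (_) _ φ')⟩⟩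

/-- A partition into two parts is determined by its smaller part. -/
lemma partitionNumber_two (m : ℕ) : partitionNumber 2 m = (Finset.Icc 1 (m / 2)).card := by
  have hpos : ∀ u ∈ Finset.Icc 1 (m / 2), 1 ≤ u ∧ 2 * u ≤ m := by
    intro u hu
    rw [Finset.mem_Icc] at hu
    omega
  let F : Finset.Icc 1 (m / 2) → {q : Nat.Partition m // q.parts.card = 2} := fun u =>
    ⟨⟨{u.1, m - u.1}, by
      intro i hi
      have := hpos u u.2
      simp only [Multiset.insert_eq_cons, Multiset.mem_cons, Multiset.mem_singleton] at hi
      omega, by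
      have := hpos u u.2
      simp only [Multiset.insert_eq_cons, Multiset.sum_cons, Multiset.sum_singleton]
      omega⟩, by simp⟩
  have hF : Function.Bijective F := by
    constructor
    · rintro ⟨u, hu⟩ ⟨v, hv⟩ h
      have h₁ := congrArg (fun q => q.1.parts) h
      have h₂ := hpos u hu
      have h₃ := hpos v hv
      have h₄ : u ∈ ({v, m - v} : Multiset ℕ) := by
        rw [← show ({u, m - u} : Multiset ℕ) = {v, m - v} from h₁]
        simp
      have h₅ : v ∈ ({u, m - u} : Multiset ℕ) := by
        rw [show ({u, m - u} : Multiset ℕ) = {v, m - v} from h₁]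
        simp
      simp only [Multiset.insert_eq_cons, Multiset.mem_cons, Multiset.mem_singleton] at h₄ h₅
      simp only [Subtype.mk.injEq]
      omega
    · rintro ⟨q, hq⟩
      obtain ⟨x, y, hxy⟩ := Multiset.card_eq_two.1 hq
      have hsum := q.parts_sum
      have hx : 0 < x := q.parts_pos (by rw [hxy]; simp)
      have hy : 0 < y := q.parts_pos (by rw [hxy]; simp)
      rw [hxy] at hsum
      simp only [Multiset.insert_eq_cons, Multiset.sum_cons, Multiset.sum_singleton] at hsum
      rcases le_total x y with h | h
      · refine ⟨⟨x, Finset.mem_Icc.2 (by omega)⟩, Subtype.ext (Nat.Partition.ext ?_)⟩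
        change ({x, m - x} : Multiset ℕ) = q.parts
        rw [hxy, show m - x = y by omega]
      · refine ⟨⟨y, Finset.mem_Icc.2 (by omega)⟩, Subtype.ext (Nat.Partition.ext ?_)⟩
        change ({y, m - y} : Multiset ℕ) = q.parts
        rw [hxy, show m - y = x by omega, Multiset.pair_comm]
  rw [partitionNumber, ← Nat.card_eq_of_bijective F hF, Nat.card_eq_fintype_card,
    Fintype.card_coe]

lemma mem_sortedSizes {n : Fin 6 → ℕ} : n ∈ sortedSizes N ↔
    (1 ≤ n 2 ∧ 1 ≤ n 3 ∧ 1 ≤ n 4 ∧ 1 ≤ n 5) ∧ n 4 ≤ n 5 ∧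
      4 + (n 0 + n 1 + n 2 + n 3 + n 4 + n 5) = N := by
  change Admissible n ∧ _ ↔ _
  rw [Fin.sum_univ_six, admissible_iff]
  simp [Fin.forall_fin_succ, minSizes]

/-- The tuples of sizes, listed by the sizes of the chains along the first five edges. -/
def sizeIndices (N : ℕ) : Finset (Σ _ : ℕ, Σ _ : ℕ, Σ _ : ℕ, Σ _ : ℕ, ℕ) :=
  (Finset.Icc 1 (N - 7)).sigma fun t => (Finset.Icc 1 (N - t - 6)).sigma fun r =>
    (Finset.Icc 1 (N - t - r - 5)).sigma fun l => (Finset.Icc 1 (N - t - r - l - 4)).sigma fun i =>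
      Finset.Icc 1 ((N - t - r - l - i - 2) / 2)

lemma card_sortedSizes (hN : 8 ≤ N) : Nat.card (sortedSizes N) =
    ∑ t ∈ Finset.Icc 1 (N - 7), ∑ r ∈ Finset.Icc 1 (N - t - 6),
      ∑ l ∈ Finset.Icc 1 (N - t - r - 5), ∑ i ∈ Finset.Icc 1 (N - t - r - l - 4),
        partitionNumber 2 (N - t - r - l - i - 2) := by
  have hsum : (sizeIndices N).card = ∑ t ∈ Finset.Icc 1 (N - 7), ∑ r ∈ Finset.Icc 1 (N - t - 6),
      ∑ l ∈ Finset.Icc 1 (N - t - r - 5), ∑ i ∈ Finset.Icc 1 (N - t - r - l - 4),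
        partitionNumber 2 (N - t - r - l - i - 2) := by
    simp only [sizeIndices, Finset.card_sigma, partitionNumber_two]
  -- The outer ranges are implied by the innermost one, and the truncated subtractions collapse to a
  -- single inequality.
  have hmem : ∀ t r l i u, (⟨t, r, l, i, u⟩ : Σ _ : ℕ, Σ _ : ℕ, Σ _ : ℕ, Σ _ : ℕ, ℕ) ∈ sizeIndices N
      ↔ 1 ≤ t ∧ 1 ≤ r ∧ 1 ≤ l ∧ 1 ≤ i ∧ 1 ≤ u ∧ t + r + l + i + 2 + 2 * u ≤ N := by
    intro t r l i u
    simp only [sizeIndices, Finset.mem_sigma, Finset.mem_Icc]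
    omega
  rw [← hsum, ← Fintype.card_coe, ← Nat.card_eq_fintype_card]
  -- The indices `t` and `r` start at `1` while the sizes `n 0` and `n 1` may vanish, hence the two
  -- decrements; the last entry is what remains for `n 5`.
  let F : sizeIndices N → sortedSizes N := fun q =>
    ⟨![q.1.1 - 1, q.1.2.1 - 1, q.1.2.2.1, q.1.2.2.2.1, q.1.2.2.2.2,
      N - q.1.1 - q.1.2.1 - q.1.2.2.1 - q.1.2.2.2.1 - 2 - q.1.2.2.2.2], by
      obtain ⟨⟨t, r, l, i, u⟩, hq⟩ := q
      rw [hmem] at hq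
      rw [mem_sortedSizes]
      simp
      omega⟩
  refine (Nat.card_eq_of_bijective F ⟨?_, ?_⟩).symm
  · rintro ⟨⟨t, r, l, i, u⟩, hq⟩ ⟨⟨t', r', l', i', u'⟩, hq'⟩ h
    rw [hmem] at hq hq'
    have h := congrArg Subtype.val h
    have h₀ : t - 1 = t' - 1 := congrFun h 0
    have h₁ : r - 1 = r' - 1 := congrFun h 1
    have h₂ : l = l' := congrFun h 2
    have h₃ : i = i' := congrFun h 3
    have h₄ : u = u' := congrFun h 4
    obtain rfl : t = t' := by omega
    obtain rfl : r = r' := by omega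
    subst h₂ h₃ h₄
    rfl
  · rintro ⟨n, hn⟩
    have h := mem_sortedSizes.1 hn
    refine ⟨⟨⟨n 0 + 1, n 1 + 1, n 2, n 3, n 4⟩, (hmem _ _ _ _ _).2 (by omega)⟩,
      Subtype.ext (funext fun k => ?_)⟩
    fin_cases k <;> simp [F]
    omega

end Count

/-! ### The seven basic blocks -/

section BasicBlocks

open Node

instance (s : Shape) : DecidableLE (Node s) := fun x y => by
  change Decidable (x.hi ≤ y.lo ∨ AlongLE x y)
  cases x <;> cases y <;> unfold AlongLE <;> infer_instance

instance (s : Shape) (n : Fin 6 → ℕ) (x : Node s) : Decidable (x ∈ glued s n) :=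
  match x with
  | vert i => inferInstanceAs (Decidable (i < 4))
  | mid k m => inferInstanceAs (Decidable (m < n k))

/-- An adjunct of a chain with five elements that matches the smallest glued poset of a shape. -/
lemma nonempty_iso_glued {s : Shape} {p : Fin 3 → AdjunctPair 5} (g : Fin 5 → Node s)
    (h : Fin 3 → Node s) (hg : ∀ x, g x ∈ glued s minSizes) (hh : ∀ k, h k ∈ glued s minSizes)
    (hgg : ∀ x y, g x ≤ g y ↔ x ≤ y) (hgh : ∀ x k, g x ≤ h k ↔ x ≤ (p k).1.1)
    (hhg : ∀ k y, h k ≤ g y ↔ (p k).1.2 ≤ y)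
    (hhh : ∀ k l, h k ≤ h l ↔ k = l ∨ (p k).1.2 ≤ (p l).1.1) :
    Nonempty (ChainAdjunct p ≃o glued s minSizes) := by
  let e : ChainAdjunct p ≃ Fin 5 ⊕ Fin 3 :=
    { toFun := fun x => match x with
        | .base x => Sum.inl x
        | .new k => Sum.inr k
      invFun := Sum.elim .base .new
      left_inv := by rintro (_ | _) <;> rfl
      right_inv := by rintro (_ | _) <;> rfl }
  have : Finite (ChainAdjunct p) := Finite.of_equiv _ e.symm
  let f : ChainAdjunct p → glued s minSizes := fun x => match x with
    | .base x => ⟨g x, hg x⟩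
    | .new k => ⟨h k, hh k⟩
  have hf : ∀ a b, f a ≤ f b ↔ a ≤ b := by
    rintro (x | k) (y | l)
    · exact hgg x y
    · exact hgh x l
    · exact hhg k y
    · exact hhh k l
  -- Both posets have eight elements, so the embedding is onto.
  have hsurj : Function.Surjective (OrderEmbedding.ofMapLEIff f hf) := by
    refine ((OrderEmbedding.ofMapLEIff f hf).injective.bijective_of_nat_card_le ?_).2
    rw [card_glued, Nat.card_congr e]
    simp [Fin.sum_univ_six, minSizes]
  exact ⟨RelIso.ofSurjective _ hsurj⟩

/-- The edges of `B_6`. -/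
def shapeB6 : Shape where
  src := ![0, 1, 1, 0, 2, 2]
  tgt := ![1, 2, 3, 2, 3, 3]
  src_lt := by decide
  tgt_le := by decide
  src_parallel := by decide
  tgt_parallel := by decide
  parallel := by decide
  short_zero := by decide
  short_one := by decide
  long_two := by decide
  long_three := by decide
  consecutive := by decide
  branching := by decide

/-- The only irreducible element of the five-element chain serves as the inner node of the edge `4`.
The adjoined element with the same neighbours is its parallel `mid 5 0`; the other two lie on the
long edges. -/
lemma nonempty_iso_B6 : Nonempty (ChainAdjunct pairsB6 ≃o glued shapeB6 minSizes) :=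
  nonempty_iso_glued ![vert 0, vert 1, vert 2, mid 4 0, vert 3] ![mid 2 0, mid 5 0, mid 3 0]
    (by decide) (by decide) (by decide) (by decide) (by decide) (by decide)

/-- The edges of `B_7`. -/
def shapeB7 : Shape where
  src := ![1, 2, 0, 1, 0, 0]
  tgt := ![2, 3, 2, 3, 1, 1]
  src_lt := by decide
  tgt_le := by decide
  src_parallel := by decide
  tgt_parallel := by decide
  parallel := by decide
  short_zero := by decide
  short_one := by decide
  long_two := by decide
  long_three := by decide
  consecutive := by decide
  branching := by decide

lemma nonempty_iso_B7 : Nonempty (ChainAdjunct pairsB7 ≃o glued shapeB7 minSizes) :=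
  nonempty_iso_glued ![vert 0, mid 4 0, vert 1, vert 2, vert 3] ![mid 2 0, mid 5 0, mid 3 0]
    (by decide) (by decide) (by decide) (by decide) (by decide) (by decide)

/-- The edges of `B_8`. -/
def shapeB8 : Shape where
  src := ![0, 1, 1, 0, 2, 2]
  tgt := ![1, 2, 3, 3, 3, 3]
  src_lt := by decide
  tgt_le := by decide
  src_parallel := by decide
  tgt_parallel := by decide
  parallel := by decide
  short_zero := by decide
  short_one := by decide
  long_two := by decide
  long_three := by decide
  consecutive := by decide
  branching := by decide

lemma nonempty_iso_B8 : Nonempty (ChainAdjunct pairsB8 ≃o glued shapeB8 minSizes) :=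
  nonempty_iso_glued ![vert 0, vert 1, vert 2, mid 4 0, vert 3] ![mid 2 0, mid 5 0, mid 3 0]
    (by decide) (by decide) (by decide) (by decide) (by decide) (by decide)

/-- The edges of `B_9`. -/
def shapeB9 : Shape where
  src := ![1, 2, 0, 0, 0, 0]
  tgt := ![2, 3, 2, 3, 1, 1]
  src_lt := by decide
  tgt_le := by decide
  src_parallel := by decide
  tgt_parallel := by decide
  parallel := by decide
  short_zero := by decide
  short_one := by decide
  long_two := by decide
  long_three := by decide
  consecutive := by decide
  branching := by decide

lemma nonempty_iso_B9 : Nonempty (ChainAdjunct pairsB9 ≃o glued shapeB9 minSizes) :=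
  nonempty_iso_glued ![vert 0, mid 4 0, vert 1, vert 2, vert 3] ![mid 2 0, mid 5 0, mid 3 0]
    (by decide) (by decide) (by decide) (by decide) (by decide) (by decide)

/-- The edges of `B_10`. -/
def shapeB10 : Shape where
  src := ![0, 2, 0, 0, 1, 1]
  tgt := ![1, 3, 2, 3, 2, 2]
  src_lt := by decide
  tgt_le := by decide
  src_parallel := by decide
  tgt_parallel := by decide
  parallel := by decide
  short_zero := by decide
  short_one := by decide
  long_two := by decide
  long_three := by decide
  consecutive := by decide
  branching := by decide

/-- Here the parallel edges join the two middle vertices, so the irreducible element of the chain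
sits between `vert 1` and `vert 2`. -/
lemma nonempty_iso_B10 : Nonempty (ChainAdjunct pairsB10 ≃o glued shapeB10 minSizes) :=
  nonempty_iso_glued ![vert 0, vert 1, mid 4 0, vert 2, vert 3] ![mid 5 0, mid 2 0, mid 3 0]
    (by decide) (by decide) (by decide) (by decide) (by decide) (by decide)

/-- The edges of `B_11`. -/
def shapeB11 : Shape where
  src := ![0, 2, 1, 0, 1, 1]
  tgt := ![1, 3, 3, 3, 2, 2]
  src_lt := by decide
  tgt_le := by decide
  src_parallel := by decide
  tgt_parallel := by decide
  parallel := by decide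
  short_zero := by decide
  short_one := by decide
  long_two := by decide
  long_three := by decide
  consecutive := by decide
  branching := by decide

lemma nonempty_iso_B11 : Nonempty (ChainAdjunct pairsB11 ≃o glued shapeB11 minSizes) :=
  nonempty_iso_glued ![vert 0, vert 1, mid 4 0, vert 2, vert 3] ![mid 5 0, mid 2 0, mid 3 0]
    (by decide) (by decide) (by decide) (by decide) (by decide) (by decide)

/-- The edges of `B_12`. -/
def shapeB12 : Shape where
  src := ![0, 2, 1, 0, 1, 1]
  tgt := ![1, 3, 3, 2, 2, 2]
  src_lt := by decide
  tgt_le := by decide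
  src_parallel := by decide
  tgt_parallel := by decide
  parallel := by decide
  short_zero := by decide
  short_one := by decide
  long_two := by decide
  long_three := by decide
  consecutive := by decide
  branching := by decide

lemma nonempty_iso_B12 : Nonempty (ChainAdjunct pairsB12 ≃o glued shapeB12 minSizes) :=
  nonempty_iso_glued ![vert 0, vert 1, mid 4 0, vert 2, vert 3] ![mid 5 0, mid 2 0, mid 3 0]
    (by decide) (by decide) (by decide) (by decide) (by decide) (by decide)

end BasicBlocks

theorem mainTheorem11 (j : ℕ) (hj : 8 ≤ j) :
    ∀ p ∈ [pairsB6, pairsB7, pairsB8, pairsB9, pairsB10, pairsB11, pairsB12],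
      numBlocks (ChainAdjunct p) j 4 3 =
        ∑ t ∈ Finset.Icc 1 (j - 7), ∑ r ∈ Finset.Icc 1 (j - t - 6),
          ∑ l ∈ Finset.Icc 1 (j - t - r - 5), ∑ i ∈ Finset.Icc 1 (j - t - r - l - 4),
            partitionNumber 2 (j - t - r - l - i - 2) := by
  have key : ∀ (p : Fin 3 → AdjunctPair 5) (s : Shape),
      Nonempty (ChainAdjunct p ≃o glued s minSizes) →
      numBlocks (ChainAdjunct p) j 4 3 = Nat.card (sortedSizes j) :=
    fun p s ⟨ψ⟩ => numBlocks_eq_card_sortedSizes ψ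
  intro p hp
  rw [← card_sortedSizes hj]
  simp only [List.mem_cons, List.not_mem_nil, or_false] at hp
  rcases hp with rfl | rfl | rfl | rfl | rfl | rfl | rfl
  · exact key _ _ nonempty_iso_B6
  · exact key _ _ nonempty_iso_B7
  · exact key _ _ nonempty_iso_B8
  · exact key _ _ nonempty_iso_B9
  · exact key _ _ nonempty_iso_B10
  · exact key _ _ nonempty_iso_B11
  · exact key _ _ nonempty_iso_B12
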